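/- Let $(V_4,g)$ be an oriented smooth space-time of signature $(-,+,+,+)$ with volume element $\eta$, and let $U$ be the canonical 2-form (metric volume element of the time-like plane $V$) of a smooth 2+2 almost-product structure, i.e. of a time-like plane field $V$ with space-like orthogonal complement $H$. Use $(A\cdot B)_{\alpha\beta}=A_\alpha{}^{\mu}B_{\mu\beta}$, $A(x)_\mu=A_{\mu\nu}x^\nu$ and $(*F)_{\alpha\beta}=\frac12\eta_{\alpha\beta\mu\nu}F^{\mu\nu}$. The projectors on $V$ and $H$ are $v=U\cdot U$ and $h=g-v$, and the structure tensor is $\Pi=v-h$. Assume that the structure is umbilical: both $V$ and $H$ are umbilical, where a plane field with projector $p$ is umbilical if the symmetric part $S$ of its second fundamental form $Q(x,y)=(1-p)(\nabla_{p(x)}p(y))$ satisfies $S=\frac12\,p\otimes\operatorname{tr}S$. Let $\delta$ be the exterior codifferential, $(\delta F)_\beta=-\nabla^\alpha F_{\alpha\beta}$ on 2-forms and $\delta\omega=-\nabla^\alpha\omega_\alpha$ on 1-forms. Define the expansion and rotation vectors $$\Phi=*U(\delta *U)-U(\delta U),\qquad \Psi=*U(\delta U)+U(\delta *U),$$ and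 the symmetric tensors $$M=\mathcal L_\Phi g-\Phi\otimes\Phi+\Psi\otimes\Psi,\qquad N=\mathcal L_\Psi g-(\Phi\otimes\Psi+\Psi\otimes\Phi).$$ Let $Riem$ and $Ric$ be the Riemann and Ricci tensors, with the sign convention in which $Ric$ and $R_{abab}$ (in an orthonormal basis) are positive for round spheres. Then at each point there are unique scalars $X,Y$ such that the total projections of $Riem$ on $V$ and on $H$ are $$v(Riem)=-X\,U\otimes U,\qquad h(Riem)=Y\,{*U}\otimes{*U},$$ and the Ricci tensor is $$Ric=\tfrac14\,(\hat R\,g+\hat r\,\Pi)+\tfrac12\,(M-U\cdot N\cdot *U-*U\cdot N\cdot U),$$ where $$2\hat R=4(X+Y)+3\Phi^2-3\Psi^2-2\,\delta\Phi,\qquad 2\hat r=4(X-Y)+\Pi(\Phi,\Phi)-\Pi(\Psi,\Psi)+2\,\delta_\Pi\Phi,$$ with $\Phi^2=g(\Phi,\Phi)$, $\Psi^2=g(\Psi,\Psi)$ and $\delta_\Pi\Phi=-\Pi^{\alpha\beta}\nabla_\alpha\Phi_\beta$. Thus, apart from the two scalars $X$ and $Y$, the Ricci tensor is expressed explicitly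 through $g$, $U$ and the first and second derivatives of $U$. -/

import Mathlib

open scoped Manifold ContDiff Matrix

noncomputable section

/-- The model space of a four-dimensional manifold. -/
abbrev E4 : Type := EuclideanSpace ℝ (Fin 4)

/-- Components `T_{ij}` of a covariant 2-tensor at a point, in a fixed coordinate system. -/
abbrev Tensor2 : Type := Matrix (Fin 4) (Fin 4) ℝ

/-! ### Pointwise tensor algebra in coordinates

All tensors are given by their covariant components; `g` is the matrix of the metric at the point
and `g⁻¹` its inverse, so that indices are raised with `g⁻¹`. -/

namespace Coord

/-- `(A · B)_{ij} = A_i^m B_{mj}`. -/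
def dot (g A B : Tensor2) : Tensor2 := A * g⁻¹ * B

/-- `A(x)_i = A_{im} x^m`, for a 1-form `x` whose index is raised with `g`. -/
def app (g A : Tensor2) (x : Fin 4 → ℝ) : Fin 4 → ℝ := A *ᵥ (g⁻¹ *ᵥ x)

/-- `(A ⊗ B)_{ij} = A_i B_j` for 1-forms. -/
def tensor (A B : Fin 4 → ℝ) : Tensor2 := Matrix.vecMulVec A B

/-- The full contraction `A^{ij} x_i y_j` of a covariant 2-tensor with two 1-forms;
`contract g g x x` is the square `x²`. -/
def contract (g A : Tensor2) (x y : Fin 4 → ℝ) : ℝ := (g⁻¹ *ᵥ x) ⬝ᵥ (A *ᵥ (g⁻¹ *ᵥ y))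

/-- The Hodge dual of a 2-form: `(*F)_{ij} = (1/2) η_{ijkl} F^{kl}`. -/
def star (g : Tensor2) (η : Fin 4 → Fin 4 → Fin 4 → Fin 4 → ℝ) (F : Tensor2) : Tensor2 :=
  Matrix.of fun i j => (1 / 2) * ∑ k, ∑ l, η i j k l * (g⁻¹ * F * g⁻¹ᵀ) k l

/-- The total projection of a 4-tensor with the projector `P`:
`P_i^a P_j^b P_k^c P_l^d t_{abcd}`. -/
def totalProj (g P : Tensor2) (t : Fin 4 → Fin 4 → Fin 4 → Fin 4 → ℝ) (i j k l : Fin 4) : ℝ :=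
  ∑ a, ∑ b, ∑ c, ∑ d,
    (P * g⁻¹) i a * (P * g⁻¹) j b * (P * g⁻¹) k c * (P * g⁻¹) l d * t a b c d

/-! ### Tensor calculus in coordinates

Tensor fields are now functions of the coordinates `y : E4`. -/

/-- The partial derivative `∂_k f`. -/
def pd (k : Fin 4) (f : E4 → ℝ) (y : E4) : ℝ := fderiv ℝ f y (EuclideanSpace.single k 1)

/-- The Christoffel symbols `Γ^k_{ij}` of the Levi-Civita connection of `g`. -/
def christoffel (g : E4 → Tensor2) (k i j : Fin 4) (y : E4) : ℝ :=
  (1 / 2) * ∑ l, (g y)⁻¹ k l *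
    (pd i (fun z => g z j l) y + pd j (fun z => g z i l) y - pd l (fun z => g z i j) y)

/-- The curvature components
`R^a_{bcd} = ∂_c Γ^a_{db} - ∂_d Γ^a_{cb} + Γ^a_{cm} Γ^m_{db} - Γ^a_{dm} Γ^m_{cb}`. -/
def riemannUp (g : E4 → Tensor2) (a b c d : Fin 4) (y : E4) : ℝ :=
  pd c (christoffel g a d b) y - pd d (christoffel g a c b) y
    + ∑ m, (christoffel g a c m y * christoffel g m d b y
      - christoffel g a d m y * christoffel g m c b y)

/-- The Riemann tensor `R_{abcd} = g_{am} R^m_{bcd}`. -/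
def riemann (g : E4 → Tensor2) (y : E4) (a b c d : Fin 4) : ℝ :=
  ∑ m, g y a m * riemannUp g m b c d y

/-- The Ricci tensor `R_{bd} = R^a_{bad}`, positive for round spheres. -/
def ricci (g : E4 → Tensor2) (y : E4) : Tensor2 :=
  Matrix.of fun b d => ∑ a, riemannUp g a b a d y

/-- `∇_i α_j` for a 1-form `α`. -/
def covDeriv₁ (g : E4 → Tensor2) (α : E4 → Fin 4 → ℝ) (y : E4) (i j : Fin 4) : ℝ :=
  pd i (fun z => α z j) y - ∑ m, christoffel g m i j y * α y m

/-- `∇_k F_{ij}` for a covariant 2-tensor `F`. -/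
def covDeriv₂ (g : E4 → Tensor2) (F : E4 → Tensor2) (y : E4) (k i j : Fin 4) : ℝ :=
  pd k (fun z => F z i j) y
    - ∑ m, christoffel g m k i y * F y m j - ∑ m, christoffel g m k j y * F y i m

/-- The scalar `δ_P α = -P^{ij} ∇_i α_j`, for a covariant 2-tensor `P` and a 1-form `α`. -/
def codiffWith (g P : E4 → Tensor2) (α : E4 → Fin 4 → ℝ) (y : E4) : ℝ :=
  - ∑ i, ∑ j, ((g y)⁻¹ * P y * (g y)⁻¹ᵀ) i j * covDeriv₁ g α y i j

/-- The exterior codifferential of a 1-form, `δα = -g^{ij} ∇_i α_j`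
(this is `* d *` in Lorentzian signature). -/
def codiff₁ (g : E4 → Tensor2) (α : E4 → Fin 4 → ℝ) (y : E4) : ℝ :=
  - ∑ i, ∑ j, (g y)⁻¹ i j * covDeriv₁ g α y i j

/-- The exterior codifferential of a 2-form, `(δF)_j = -g^{ki} ∇_k F_{ij}`
(this is `* d *` in Lorentzian signature). -/
def codiff₂ (g : E4 → Tensor2) (F : E4 → Tensor2) (y : E4) (j : Fin 4) : ℝ :=
  - ∑ k, ∑ i, (g y)⁻¹ k i * covDeriv₂ g F y k i j

/-- The Lie derivative of the metric with respect to the vector field `s` metrically equivalent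
to the 1-form `α`: `s^m ∂_m g_{ij} + g_{mj} ∂_i s^m + g_{im} ∂_j s^m`. -/
def lieMetric (g : E4 → Tensor2) (α : E4 → Fin 4 → ℝ) (y : E4) : Tensor2 :=
  Matrix.of fun i j => ∑ m,
    (((g y)⁻¹ *ᵥ α y) m * pd m (fun z => g z i j) y
      + g y m j * pd i (fun z => ((g z)⁻¹ *ᵥ α z) m) y
      + g y i m * pd j (fun z => ((g z)⁻¹ *ᵥ α z) m) y)

/-! ### Second fundamental form of a plane field

A non-null plane field is given by its orthogonal projector `P`, with covariant components. -/

/-- The second fundamental form `Q(∂_i, ∂_j)^k = ((1 - P)(∇_{P ∂_i} (P ∂_j)))^k`. -/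
def secondForm (g P : E4 → Tensor2) (y : E4) (i j k : Fin 4) : ℝ :=
  ∑ l, ∑ a, (1 - (g y)⁻¹ * P y) k l * ((g y)⁻¹ * P y) a i *
    (pd a (fun z => ((g z)⁻¹ * P z) l j) y
      + ∑ m, christoffel g l a m y * ((g y)⁻¹ * P y) m j)

/-- The symmetric part `S` of the second fundamental form. -/
def symForm (g P : E4 → Tensor2) (y : E4) (i j k : Fin 4) : ℝ :=
  (1 / 2) * (secondForm g P y i j k + secondForm g P y j i k)

/-- The trace of `S` in its two arguments. -/
def traceForm (g P : E4 → Tensor2) (y : E4) (k : Fin 4) : ℝ :=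
  ∑ i, ∑ j, (g y)⁻¹ i j * symForm g P y i j k

/-- A field of 2-planes is umbilical at `y` when the traceless part
`S - (1/2) P ⊗ tr S` of `S` vanishes. -/
def IsUmbilicalAt (g P : E4 → Tensor2) (y : E4) : Prop :=
  ∀ i j k, symForm g P y i j k - (1 / 2) * P y i j * traceForm g P y k = 0

/-! ### Concomitants of a 2+2 structure

`g` is the metric, `η` the volume element and `U` the canonical 2-form. -/

/-- The field `*U`. -/
def starField (g : E4 → Tensor2) (η : E4 → Fin 4 → Fin 4 → Fin 4 → Fin 4 → ℝ)
    (U : E4 → Tensor2) (y : E4) : Tensor2 := star (g y) (η y) (U y)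

/-- The projector `v = U · U` on the time-like plane. -/
def vProj (g U : E4 → Tensor2) (y : E4) : Tensor2 := dot (g y) (U y) (U y)

/-- The projector `h = g - v` on the space-like plane. -/
def hProj (g U : E4 → Tensor2) (y : E4) : Tensor2 := g y - vProj g U y

/-- The structure tensor `Π = v - h`. -/
def structureTensor (g U : E4 → Tensor2) (y : E4) : Tensor2 := vProj g U y - hProj g U y

/-- The expansion vector `Φ = *U(δ*U) - U(δU)`. -/
def expansion (g : E4 → Tensor2) (η : E4 → Fin 4 → Fin 4 → Fin 4 → Fin 4 → ℝ)
    (U : E4 → Tensor2) (y : E4) : Fin 4 → ℝ :=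
  app (g y) (starField g η U y) (codiff₂ g (starField g η U) y)
    - app (g y) (U y) (codiff₂ g U y)

/-- The rotation vector `Ψ = *U(δU) + U(δ*U)`. -/
def rotation (g : E4 → Tensor2) (η : E4 → Fin 4 → Fin 4 → Fin 4 → Fin 4 → ℝ)
    (U : E4 → Tensor2) (y : E4) : Fin 4 → ℝ :=
  app (g y) (starField g η U y) (codiff₂ g U y)
    + app (g y) (U y) (codiff₂ g (starField g η U) y)

/-- `M = 𝓛_Φ g - Φ ⊗ Φ + Ψ ⊗ Ψ`. -/
def tensorM (g : E4 → Tensor2) (η : E4 → Fin 4 → Fin 4 → Fin 4 → Fin 4 → ℝ)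
    (U : E4 → Tensor2) (y : E4) : Tensor2 :=
  lieMetric g (expansion g η U) y
    - tensor (expansion g η U y) (expansion g η U y)
    + tensor (rotation g η U y) (rotation g η U y)

/-- `N = 𝓛_Ψ g - (Φ ⊗ Ψ + Ψ ⊗ Φ)`. -/
def tensorN (g : E4 → Tensor2) (η : E4 → Fin 4 → Fin 4 → Fin 4 → Fin 4 → ℝ)
    (U : E4 → Tensor2) (y : E4) : Tensor2 :=
  lieMetric g (rotation g η U) y
    - (tensor (expansion g η U y) (rotation g η U y)
      + tensor (rotation g η U y) (expansion g η U y))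

/-- The scalars `X`, `Y` are the curvatures of the structure at `y`:
`v(Riem) = -X U ⊗ U` and `h(Riem) = Y *U ⊗ *U`. -/
def IsCurvaturePair (g : E4 → Tensor2) (η : E4 → Fin 4 → Fin 4 → Fin 4 → Fin 4 → ℝ)
    (U : E4 → Tensor2) (y : E4) (X Y : ℝ) : Prop :=
  (∀ i j k l, totalProj (g y) (vProj g U y) (riemann g y) i j k l = -X * (U y i j * U y k l)) ∧
  (∀ i j k l, totalProj (g y) (hProj g U y) (riemann g y) i j k l
    = Y * (starField g η U y i j * starField g η U y k l))

/-- `R̂`, where `2 R̂ = 4 (X + Y) + 3 Φ² - 3 Ψ² - 2 δΦ`. -/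
def scalarRHat (g : E4 → Tensor2) (η : E4 → Fin 4 → Fin 4 → Fin 4 → Fin 4 → ℝ)
    (U : E4 → Tensor2) (y : E4) (X Y : ℝ) : ℝ :=
  (1 / 2) * (4 * (X + Y)
    + 3 * contract (g y) (g y) (expansion g η U y) (expansion g η U y)
    - 3 * contract (g y) (g y) (rotation g η U y) (rotation g η U y)
    - 2 * codiff₁ g (expansion g η U) y)

/-- `r̂`, where `2 r̂ = 4 (X - Y) + Π(Φ, Φ) - Π(Ψ, Ψ) + 2 δ_Π Φ`
and `δ_Π Φ = -Π^{ij} ∇_i Φ_j`. -/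
def scalarSmallRHat (g : E4 → Tensor2) (η : E4 → Fin 4 → Fin 4 → Fin 4 → Fin 4 → ℝ)
    (U : E4 → Tensor2) (y : E4) (X Y : ℝ) : ℝ :=
  (1 / 2) * (4 * (X - Y)
    + contract (g y) (structureTensor g U y) (expansion g η U y) (expansion g η U y)
    - contract (g y) (structureTensor g U y) (rotation g η U y) (rotation g η U y)
    + 2 * codiffWith g (structureTensor g U) (expansion g η U) y)

end Coord

/-! ### Space-times -/

section Manifold

variable {M : Type*} [TopologicalSpace M] [ChartedSpace E4 M]

/-- The coordinate vector `∂_i` of the chart `e` at the point with coordinates `y`. -/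
def coordVec (e : OpenPartialHomeomorph M E4) (y : E4) (i : Fin 4) :
    TangentSpace (𝓡 4) (e.symm y) :=
  mfderiv (𝓡 4) (𝓡 4) e.symm y (EuclideanSpace.single i (1 : ℝ) : E4)

/-- The components `T_{ij}` in the chart `e` of a field `T` of bilinear forms. -/
def comp₂ (T : ∀ p : M, LinearMap.BilinForm ℝ (TangentSpace (𝓡 4) p))
    (e : OpenPartialHomeomorph M E4) (y : E4) : Tensor2 :=
  Matrix.of fun i j => T (e.symm y) (coordVec e y i) (coordVec e y j)

/-- The components `T_{ijkl}` in the chart `e` of a field `T` of alternating 4-forms. -/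
def comp₄ (T : ∀ p : M, (TangentSpace (𝓡 4) p) [⋀^Fin 4]→ₗ[ℝ] ℝ)
    (e : OpenPartialHomeomorph M E4) (y : E4) (i j k l : Fin 4) : ℝ :=
  T (e.symm y) ![coordVec e y i, coordVec e y j, coordVec e y k, coordVec e y l]

/-- Smoothness of a field of bilinear forms: smooth components in every chart. -/
def IsSmooth₂ (T : ∀ p : M, LinearMap.BilinForm ℝ (TangentSpace (𝓡 4) p)) : Prop :=
  ∀ e ∈ IsManifold.maximalAtlas (𝓡 4) ∞ M, ∀ i j,
    ContDiffOn ℝ ∞ (fun y => comp₂ T e y i j) e.target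

/-- Smoothness of a field of 4-forms: smooth components in every chart. -/
def IsSmooth₄ (T : ∀ p : M, (TangentSpace (𝓡 4) p) [⋀^Fin 4]→ₗ[ℝ] ℝ) : Prop :=
  ∀ e ∈ IsManifold.maximalAtlas (𝓡 4) ∞ M, ∀ i j k l,
    ContDiffOn ℝ ∞ (fun y => comp₄ T e y i j k l) e.target

/-- `b` is an orthonormal frame for a form of signature `(-,+,+,+)`, with `b 0` time-like. -/
def IsLorentzFrame {V : Type*} [AddCommGroup V] [Module ℝ V] (B : LinearMap.BilinForm ℝ V)
    (b : Fin 4 → V) : Prop :=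
  ∀ i j, B (b i) (b j) = Matrix.diagonal ![(-1 : ℝ), 1, 1, 1] i j

variable (M) in
/-- An oriented space-time structure on the 4-manifold `M`: a smooth metric of signature
`(-,+,+,+)`, and an orientation, given by the metric volume element `η`. -/
structure OrientedSpacetime where
  metric : ∀ p : M, LinearMap.BilinForm ℝ (TangentSpace (𝓡 4) p)
  metric_symm : ∀ p x y, metric p x y = metric p y x
  metric_lorentz : ∀ p, ∃ b, IsLorentzFrame (metric p) b
  metric_smooth : IsSmooth₂ metric
  volume : ∀ p : M, (TangentSpace (𝓡 4) p) [⋀^Fin 4]→ₗ[ℝ] ℝ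
  volume_frame : ∀ p b, IsLorentzFrame (metric p) b → volume p b = 1 ∨ volume p b = -1
  volume_smooth : IsSmooth₄ volume

/-- `U` is the canonical 2-form of a 2+2 structure: a smooth 2-form which at each point is the
volume element of a time-like plane (the span of `b 0` and `b 1`). -/
structure OrientedSpacetime.IsCanonicalForm (S : OrientedSpacetime M)
    (U : ∀ p : M, LinearMap.BilinForm ℝ (TangentSpace (𝓡 4) p)) : Prop where
  alt : ∀ p, (U p).IsAlt
  simple : ∀ p, ∃ b, IsLorentzFrame (S.metric p) b ∧ U p (b 0) (b 1) = 1 ∧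
    ∀ x, U p (b 2) x = 0 ∧ U p (b 3) x = 0
  smooth : IsSmooth₂ U

/-- `U` is (the canonical 2-form of) an umbilical 2+2 structure: the time-like plane field and its
orthogonal complement are both umbilical. -/
structure OrientedSpacetime.IsUmbilicalStructure (S : OrientedSpacetime M)
    (U : ∀ p : M, LinearMap.BilinForm ℝ (TangentSpace (𝓡 4) p)) : Prop where
  canonical : S.IsCanonicalForm U
  umbilical : ∀ e ∈ IsManifold.maximalAtlas (𝓡 4) ∞ M, ∀ y ∈ e.target,
    Coord.IsUmbilicalAt (comp₂ S.metric e) (Coord.vProj (comp₂ S.metric e) (comp₂ U e)) y ∧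
    Coord.IsUmbilicalAt (comp₂ S.metric e) (Coord.hProj (comp₂ S.metric e) (comp₂ U e)) y

end Manifold

end

noncomputable section

namespace Coord

/-! For an umbilical structure the whole of `∇U` is algebraic in `Φ` and `Ψ`. Differentiating `U·U·U
= U`, `*U·*U = v - g` and `U·*U = 0` shows that `∇U` and `∇*U` only mix the planes `V` and `H`, and
that the first determines the second. This leaves sixteen unknowns in an adapted orthonormal frame.
The traceless second fundamental forms of the two planes give eight equations and the definitions of
`Φ` and `Ψ` give eight more; together they solve for everything (`mixed_of_relations`,
`frame_structure_equations`).

Adapted frames are only chosen point by point, so this solution cannot be differentiated as it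
stands. It is first rewritten as a tensor identity `∇_w U = twist`, built from `g`, `U`, `*U`, `Φ`,
`Ψ` (`cov_form_eq_twist`). That identity holds on the whole chart domain, and Leibniz turns its
derivative into `covTwist`. Antisymmetrizing gives the Ricci identity: the commutator of the
curvature operator with `U` equals an explicit expression in `Φ`, `Ψ` and their covariant
derivatives (`ricci_identity`).

The commutator with `U` isolates the curvature components whose first index pair has one index in
`V` and one in `H`. By pair symmetry, every term of a Ricci component is either of this kind or is
one of `R_0101`, `R_2323`. These last two are the scalars `-X` and `Y`, since a plane carries only
one 2-form up to scale (`totalProj_eq_iff`). The formula is then a check of ten components in a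
frame (`ricci_eq_frameRicci`), carried back to coordinates by congruence with the frame matrix
(`pull`, `act`). -/

/-- Smoothness of the components of a matrix-valued field on a set. -/
def SmoothM (F : E4 → Tensor2) (Ω : Set E4) : Prop :=
  ∀ i j, ContDiffOn ℝ ∞ (fun z => F z i j) Ω

/-- Smoothness of the components of a 1-form on a set. -/
def SmoothV (α : E4 → Fin 4 → ℝ) (Ω : Set E4) : Prop :=
  ∀ i, ContDiffOn ℝ ∞ (fun z => α z i) Ω

/-- The componentwise derivative of a matrix-valued field in the direction `x`. -/
def dirM (F : E4 → Tensor2) (x y : E4) : Tensor2 :=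
  Matrix.of fun i j => fderiv ℝ (fun z => F z i j) y x

/-- The componentwise derivative of a 1-form in the direction `x`. -/
def dirV (α : E4 → Fin 4 → ℝ) (x y : E4) : Fin 4 → ℝ :=
  fun i => fderiv ℝ (fun z => α z i) y x

/-! ### Smooth component fields under matrix operations. -/

section Smoothness

variable {Ω : Set E4} {F G : E4 → Tensor2} {α β : E4 → Fin 4 → ℝ}

theorem SmoothM.mul (hF : SmoothM F Ω) (hG : SmoothM G Ω) : SmoothM (fun z => F z * G z) Ω := by
  intro i j
  simp only [Matrix.mul_apply]
  exact ContDiffOn.sum fun m _ => (hF i m).mul (hG m j)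

theorem SmoothM.add (hF : SmoothM F Ω) (hG : SmoothM G Ω) : SmoothM (fun z => F z + G z) Ω :=
  fun i j => (hF i j).add (hG i j)

theorem SmoothM.sub (hF : SmoothM F Ω) (hG : SmoothM G Ω) : SmoothM (fun z => F z - G z) Ω :=
  fun i j => (hF i j).sub (hG i j)

theorem SmoothM.transpose (hF : SmoothM F Ω) : SmoothM (fun z => (F z)ᵀ) Ω :=
  fun i j => hF j i

theorem SmoothM.mulVec (hF : SmoothM F Ω) (hα : SmoothV α Ω) :
    SmoothV (fun z => F z *ᵥ α z) Ω := by
  intro i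
  simp only [Matrix.mulVec, dotProduct]
  exact ContDiffOn.sum fun m _ => (hF i m).mul (hα m)

theorem SmoothV.add (hα : SmoothV α Ω) (hβ : SmoothV β Ω) : SmoothV (fun z => α z + β z) Ω :=
  fun i => (hα i).add (hβ i)

theorem SmoothV.sub (hα : SmoothV α Ω) (hβ : SmoothV β Ω) : SmoothV (fun z => α z - β z) Ω :=
  fun i => (hα i).sub (hβ i)

theorem SmoothV.smul (c : ℝ) (hα : SmoothV α Ω) : SmoothV (fun z => c • α z) Ω :=
  fun i => contDiffOn_const.mul (hα i)

theorem SmoothV.const (a : Fin 4 → ℝ) : SmoothV (fun _ => a) Ω := fun _ => contDiffOn_const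

theorem SmoothV.vecMulVec (hα : SmoothV α Ω) (hβ : SmoothV β Ω) :
    SmoothM (fun z => Matrix.vecMulVec (α z) (β z)) Ω :=
  fun i j => (hα i).mul (hβ j)

theorem contDiffOn_det (hF : SmoothM F Ω) : ContDiffOn ℝ ∞ (fun z => (F z).det) Ω := by
  simp only [Matrix.det_apply']
  exact ContDiffOn.sum fun σ _ =>
    contDiffOn_const.mul (contDiffOn_prod fun i _ => hF (σ i) i)

/-- Cramer's rule: an entry of the inverse is a quotient of determinants, which are polynomial in
the entries. -/
theorem SmoothM.inv (hF : SmoothM F Ω) (h0 : ∀ z ∈ Ω, (F z).det ≠ 0) :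
    SmoothM (fun z => (F z)⁻¹) Ω := by
  intro i j
  have : (fun z => (F z)⁻¹ i j)
      = fun z => ((F z).det)⁻¹ * ((F z).updateRow j (Pi.single i 1)).det := by
    ext z
    rw [Matrix.inv_def, Matrix.smul_apply, Matrix.adjugate_apply, Ring.inverse_eq_inv', smul_eq_mul]
  rw [this]
  refine ((contDiffOn_det hF).inv h0).mul (contDiffOn_det fun a b => ?_)
  by_cases h : a = j
  · subst h
    simp only [Matrix.updateRow_self]
    exact contDiffOn_const
  · simp only [Matrix.updateRow_ne h]
    exact hF a b

theorem contDiffOn_fderiv_apply {f : E4 → ℝ} (hΩ : IsOpen Ω) (hf : ContDiffOn ℝ ∞ f Ω) (x : E4) :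
    ContDiffOn ℝ ∞ (fun z => fderiv ℝ f z x) Ω :=
  (hf.fderiv_of_isOpen hΩ (by simp)).clm_apply contDiffOn_const

theorem SmoothM.dirM (hΩ : IsOpen Ω) (hF : SmoothM F Ω) (x : E4) : SmoothM (dirM F x) Ω :=
  fun i j => contDiffOn_fderiv_apply hΩ (hF i j) x

theorem differentiableAt_of_smooth {f : E4 → ℝ} (hΩ : IsOpen Ω) (hf : ContDiffOn ℝ ∞ f Ω) {y : E4}
    (hy : y ∈ Ω) : DifferentiableAt ℝ f y :=
  (hf.contDiffAt (hΩ.mem_nhds hy)).differentiableAt (by simp)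

end Smoothness

/-! ### Leibniz rules for componentwise directional derivatives. -/

section Derivative

variable {Ω : Set E4} {F G : E4 → Tensor2} {α β : E4 → Fin 4 → ℝ} {x w y : E4}

theorem fderiv_eq_sum_pd (f : E4 → ℝ) (x y : E4) : fderiv ℝ f y x = ∑ k, x k * pd k f y := by
  have hx : x = ∑ k, x k • EuclideanSpace.single k (1 : ℝ) := by
    ext i
    simp [Finset.sum_apply, Pi.single_apply]
  conv_lhs => rw [hx]
  simp [pd]

/-- Algebraic identities between fields are known only on the open chart domain; agreement near the
point is what allows them to be differentiated. -/
theorem dirM_congr (h : F =ᶠ[nhds y] G) : dirM F x y = dirM G x y := by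
  ext i j
  have : (fun z => F z i j) =ᶠ[nhds y] fun z => G z i j := h.mono fun z hz => by simp only [hz]
  simp only [dirM, Matrix.of_apply, this.fderiv_eq]

theorem dirV_congr (h : α =ᶠ[nhds y] β) : dirV α x y = dirV β x y := by
  ext i
  have : (fun z => α z i) =ᶠ[nhds y] fun z => β z i := h.mono fun z hz => by simp only [hz]
  simp only [dirV, this.fderiv_eq]

theorem dirM_const (A : Tensor2) : dirM (fun _ => A) x y = 0 := by
  ext i j
  simp [dirM]

theorem dirM_transpose : dirM (fun z => (F z)ᵀ) x y = (dirM F x y)ᵀ := rfl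

theorem dirM_mul (hΩ : IsOpen Ω) (hF : SmoothM F Ω) (hG : SmoothM G Ω) (hy : y ∈ Ω) :
    dirM (fun z => F z * G z) x y = dirM F x y * G y + F y * dirM G x y := by
  ext i j
  have hF' := fun i j => differentiableAt_of_smooth hΩ (hF i j) hy
  have hG' := fun i j => differentiableAt_of_smooth hΩ (hG i j) hy
  simp only [dirM, Matrix.of_apply, Matrix.mul_apply, Matrix.add_apply]
  rw [fderiv_fun_sum fun m _ => (hF' i m).fun_mul (hG' m j), sum_apply,
    ← Finset.sum_add_distrib]
  refine Finset.sum_congr rfl fun m _ => ?_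
  rw [fderiv_fun_mul (hF' i m) (hG' m j)]
  simp
  ring

theorem dirM_add (hΩ : IsOpen Ω) (hF : SmoothM F Ω) (hG : SmoothM G Ω) (hy : y ∈ Ω) :
    dirM (fun z => F z + G z) x y = dirM F x y + dirM G x y := by
  ext i j
  simp only [dirM, Matrix.of_apply, Matrix.add_apply]
  rw [fderiv_fun_add (differentiableAt_of_smooth hΩ (hF i j) hy)
    (differentiableAt_of_smooth hΩ (hG i j) hy)]
  rfl

theorem dirM_sub (hΩ : IsOpen Ω) (hF : SmoothM F Ω) (hG : SmoothM G Ω) (hy : y ∈ Ω) :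
    dirM (fun z => F z - G z) x y = dirM F x y - dirM G x y := by
  ext i j
  simp only [dirM, Matrix.of_apply, Matrix.sub_apply]
  rw [fderiv_fun_sub (differentiableAt_of_smooth hΩ (hF i j) hy)
    (differentiableAt_of_smooth hΩ (hG i j) hy)]
  rfl

theorem dirV_mulVec (hΩ : IsOpen Ω) (hF : SmoothM F Ω) (hα : SmoothV α Ω) (hy : y ∈ Ω) :
    dirV (fun z => F z *ᵥ α z) x y = dirM F x y *ᵥ α y + F y *ᵥ dirV α x y := by
  ext i
  have hF' := fun i j => differentiableAt_of_smooth hΩ (hF i j) hy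
  have hα' := fun i => differentiableAt_of_smooth hΩ (hα i) hy
  simp only [dirM, dirV, Matrix.mulVec, dotProduct, Matrix.of_apply, Pi.add_apply]
  rw [fderiv_fun_sum fun m _ => (hF' i m).fun_mul (hα' m), sum_apply,
    ← Finset.sum_add_distrib]
  refine Finset.sum_congr rfl fun m _ => ?_
  rw [fderiv_fun_mul (hF' i m) (hα' m)]
  simp
  ring

theorem dirV_smul (hΩ : IsOpen Ω) (c : ℝ) (hα : SmoothV α Ω) (hy : y ∈ Ω) :
    dirV (fun z => c • α z) x y = c • dirV α x y := by
  ext i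
  simp only [dirV, Pi.smul_apply, smul_eq_mul]
  rw [fderiv_const_mul (differentiableAt_of_smooth hΩ (hα i) hy)]
  rfl

theorem dirM_vecMulVec (hΩ : IsOpen Ω) (hα : SmoothV α Ω) (hβ : SmoothV β Ω) (hy : y ∈ Ω) :
    dirM (fun z => Matrix.vecMulVec (α z) (β z)) x y
      = Matrix.vecMulVec (dirV α x y) (β y) + Matrix.vecMulVec (α y) (dirV β x y) := by
  ext i j
  simp only [dirM, dirV, Matrix.vecMulVec_apply, Matrix.of_apply, Matrix.add_apply]
  rw [fderiv_fun_mul (differentiableAt_of_smooth hΩ (hα i) hy)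
    (differentiableAt_of_smooth hΩ (hβ j) hy)]
  simp
  ring

theorem fderiv_fderiv_comm (hΩ : IsOpen Ω) {f : E4 → ℝ} (hf : ContDiffOn ℝ ∞ f Ω) (hy : y ∈ Ω) :
    fderiv ℝ (fun z => fderiv ℝ f z w) y x = fderiv ℝ (fun z => fderiv ℝ f z x) y w := by
  have hd : DifferentiableAt ℝ (fderiv ℝ f) y :=
    ((hf.fderiv_of_isOpen hΩ (m := ∞) (by simp)).contDiffAt (hΩ.mem_nhds hy)).differentiableAt
      (by simp)
  have key : ∀ a b : E4, fderiv ℝ (fun z => fderiv ℝ f z a) y b = fderiv ℝ (fderiv ℝ f) y b a := by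
    intro a b
    rw [fderiv_clm_apply hd (by fun_prop)]
    simp
  rw [key, key]
  exact (hf.contDiffAt (hΩ.mem_nhds hy)).isSymmSndFDerivAt
    (by simp only [minSmoothness_of_isRCLikeNormedField]; exact WithTop.coe_le_coe.2 (le_top : (2 : ℕ∞) ≤ ⊤)) x w

theorem dirM_dirM_comm (hΩ : IsOpen Ω) (hF : SmoothM F Ω) (hy : y ∈ Ω) :
    dirM (dirM F w) x y = dirM (dirM F x) w y := by
  ext i j
  exact fderiv_fderiv_comm hΩ (hF i j) hy

end Derivative

/-! ### The connection and its curvature in matrix form, along vectors with constant coordinates. -/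

/-- The matrix `(Γ_x)^m_j = x^k Γ^m_{kj}`. -/
def connMatrix (g : E4 → Tensor2) (x y : E4) : Tensor2 :=
  Matrix.of fun m j => ∑ k, x k * christoffel g m k j y

/-- The covariant derivative `∇_x F` of a covariant 2-tensor. -/
def cov₂ (g F : E4 → Tensor2) (x y : E4) : Tensor2 :=
  dirM F x y - (connMatrix g x y)ᵀ * F y - F y * connMatrix g x y

/-- The covariant derivative `∇_x α` of a 1-form. -/
def cov₁ (g : E4 → Tensor2) (α : E4 → Fin 4 → ℝ) (x y : E4) : Fin 4 → ℝ :=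
  dirV α x y - (connMatrix g x y)ᵀ *ᵥ α y

/-- The curvature operator `R(x, w)` as a matrix acting on vectors. -/
def curvMatrix (g : E4 → Tensor2) (x w y : E4) : Tensor2 :=
  dirM (connMatrix g w) x y - dirM (connMatrix g x) w y
    + (connMatrix g x y * connMatrix g w y - connMatrix g w y * connMatrix g x y)

theorem cov₂_congr {g F G : E4 → Tensor2} {x y : E4} (h : F =ᶠ[nhds y] G) :
    cov₂ g F x y = cov₂ g G x y := by
  rw [cov₂, cov₂, dirM_congr h, h.self_of_nhds]

theorem connMatrix_single (g : E4 → Tensor2) (k : Fin 4) (y : E4) (m j : Fin 4) :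
    connMatrix g (EuclideanSpace.single k 1) y m j = christoffel g m k j y := by
  simp [connMatrix]

theorem covDeriv₁_eq (g : E4 → Tensor2) (α : E4 → Fin 4 → ℝ) (y : E4) (i j : Fin 4) :
    covDeriv₁ g α y i j = cov₁ g α (EuclideanSpace.single i 1) y j := by
  simp [covDeriv₁, cov₁, dirV, pd, Matrix.mulVec, dotProduct, connMatrix_single]

theorem covDeriv₂_eq (g F : E4 → Tensor2) (y : E4) (k i j : Fin 4) :
    covDeriv₂ g F y k i j = cov₂ g F (EuclideanSpace.single k 1) y i j := by
  simp [covDeriv₂, cov₂, dirM, pd, Matrix.mul_apply, connMatrix_single, mul_comm]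

theorem connMatrix_eq_sum (g : E4 → Tensor2) (x y : E4) :
    connMatrix g x y = ∑ k, x k • connMatrix g (EuclideanSpace.single k 1) y := by
  ext m j
  simp only [Matrix.sum_apply, Matrix.smul_apply, connMatrix_single, smul_eq_mul]
  rfl

theorem dirM_eq_sum (F : E4 → Tensor2) (x y : E4) :
    dirM F x y = ∑ k, x k • dirM F (EuclideanSpace.single k 1) y := by
  ext i j
  simp only [Matrix.sum_apply, Matrix.smul_apply, smul_eq_mul]
  exact fderiv_eq_sum_pd _ x y

theorem dirV_eq_sum (α : E4 → Fin 4 → ℝ) (x y : E4) :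
    dirV α x y = ∑ k, x k • dirV α (EuclideanSpace.single k 1) y := by
  ext i
  simp only [Finset.sum_apply, Pi.smul_apply, smul_eq_mul]
  exact fderiv_eq_sum_pd _ x y

/-- Linearity in the direction allows frame vectors in place of the coordinate vectors used in the
definitions. -/
theorem cov₂_eq_sum (g F : E4 → Tensor2) (x y : E4) :
    cov₂ g F x y = ∑ k, x k • cov₂ g F (EuclideanSpace.single k 1) y := by
  simp only [cov₂, smul_sub, Finset.sum_sub_distrib, ← dirM_eq_sum]
  rw [connMatrix_eq_sum g x]
  simp only [Matrix.transpose_sum, Matrix.transpose_smul, Matrix.sum_mul, Matrix.mul_sum,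
    Matrix.smul_mul, Matrix.mul_smul]

theorem cov₁_eq_sum (g : E4 → Tensor2) (α : E4 → Fin 4 → ℝ) (x y : E4) :
    cov₁ g α x y = ∑ k, x k • cov₁ g α (EuclideanSpace.single k 1) y := by
  simp only [cov₁, smul_sub, Finset.sum_sub_distrib, ← dirV_eq_sum]
  rw [connMatrix_eq_sum g x]
  simp only [Matrix.transpose_sum, Matrix.transpose_smul, Matrix.sum_mulVec, Matrix.smul_mulVec]

/-! ### Levi-Civita calculus: metricity, Leibniz rules, Ricci identity, curvature symmetries. -/

/-- A smooth pseudo-Riemannian metric on a set. -/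
structure IsMetricOn (g : E4 → Tensor2) (Ω : Set E4) : Prop where
  isOpen : IsOpen Ω
  smooth : SmoothM g Ω
  symm : ∀ z ∈ Ω, (g z)ᵀ = g z
  det_ne_zero : ∀ z ∈ Ω, (g z).det ≠ 0

namespace IsMetricOn

variable {g F G : E4 → Tensor2} {α β : E4 → Fin 4 → ℝ} {Ω : Set E4} {y x w : E4}

theorem isUnit_det (hg : IsMetricOn g Ω) (hy : y ∈ Ω) : IsUnit (g y).det :=
  (hg.det_ne_zero y hy).isUnit

theorem smooth_inv (hg : IsMetricOn g Ω) : SmoothM (fun z => (g z)⁻¹) Ω :=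
  hg.smooth.inv hg.det_ne_zero

theorem pd_symm (hg : IsMetricOn g Ω) (hy : y ∈ Ω) (k i j : Fin 4) :
    pd k (fun z => g z i j) y = pd k (fun z => g z j i) y := by
  have : (fun z => g z i j) =ᶠ[nhds y] fun z => g z j i := by
    filter_upwards [hg.isOpen.mem_nhds hy] with z hz
    exact congrFun (congrFun (hg.symm z hz) j) i
  simp only [pd, this.fderiv_eq]

theorem christoffel_symm (hg : IsMetricOn g Ω) (hy : y ∈ Ω) (k i j : Fin 4) :
    christoffel g k i j y = christoffel g k j i y := by
  simp only [christoffel]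
  congr 1
  refine Finset.sum_congr rfl fun l _ => ?_
  rw [hg.pd_symm hy l i j]
  ring

theorem smooth_christoffel (hg : IsMetricOn g Ω) (k i j : Fin 4) :
    ContDiffOn ℝ ∞ (christoffel g k i j) Ω := by
  have hp : ∀ k i j, ContDiffOn ℝ ∞ (pd k fun z => g z i j) Ω := fun k i j =>
    contDiffOn_fderiv_apply hg.isOpen (hg.smooth i j) _
  exact contDiffOn_const.mul (ContDiffOn.sum fun l _ =>
    (hg.smooth_inv k l).mul (((hp i j l).add (hp j i l)).sub (hp l i j)))

theorem smooth_connMatrix (hg : IsMetricOn g Ω) (x : E4) : SmoothM (connMatrix g x) Ω :=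
  fun m j => show ContDiffOn ℝ ∞ (fun z => ∑ k, x k * christoffel g m k j z) Ω from
    ContDiffOn.sum fun _ _ => contDiffOn_const.mul (hg.smooth_christoffel _ _ _)

theorem connMatrix_mulVec_comm (hg : IsMetricOn g Ω) (hy : y ∈ Ω) :
    connMatrix g x y *ᵥ w = connMatrix g w y *ᵥ x := by
  ext m
  simp only [connMatrix, Matrix.mulVec, dotProduct, Matrix.of_apply, Finset.sum_mul]
  rw [Finset.sum_comm]
  refine Finset.sum_congr rfl fun j _ => Finset.sum_congr rfl fun k _ => ?_
  rw [hg.christoffel_symm hy]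
  ring

theorem lower_christoffel (hg : IsMetricOn g Ω) (hy : y ∈ Ω) (l i j : Fin 4) :
    ∑ m, g y l m * christoffel g m i j y = (1 / 2) *
      (pd i (fun z => g z j l) y + pd j (fun z => g z i l) y - pd l (fun z => g z i j) y) := by
  set c : Fin 4 → ℝ := fun l => (1 / 2) *
      (pd i (fun z => g z j l) y + pd j (fun z => g z i l) y - pd l (fun z => g z i j) y) with hc
  have h : (fun m => christoffel g m i j y) = (g y)⁻¹ *ᵥ c := by
    ext m
    simp only [christoffel, Matrix.mulVec, dotProduct, hc, Finset.mul_sum]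
    exact Finset.sum_congr rfl fun l _ => by ring
  have h2 : g y *ᵥ (fun m => christoffel g m i j y) = c := by
    rw [h, Matrix.mulVec_mulVec, Matrix.mul_nonsing_inv _ (hg.isUnit_det hy), Matrix.one_mulVec]
  exact congrFun h2 l

theorem cov_metric (hg : IsMetricOn g Ω) (hy : y ∈ Ω) : cov₂ g g x y = 0 := by
  rw [cov₂_eq_sum]
  refine Finset.sum_eq_zero fun k _ => ?_
  suffices h : cov₂ g g (EuclideanSpace.single k 1) y = 0 by rw [h, smul_zero]
  ext i j
  rw [← covDeriv₂_eq, covDeriv₂]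
  have h1 := hg.lower_christoffel hy j k i
  have h2 := hg.lower_christoffel hy i k j
  have h3 : ∑ m, christoffel g m k i y * g y m j = ∑ m, g y j m * christoffel g m k i y :=
    Finset.sum_congr rfl fun m _ => by
      rw [mul_comm, show g y m j = g y j m from congrFun (congrFun (hg.symm y hy) j) m]
  have h4 : ∑ m, christoffel g m k j y * g y i m = ∑ m, g y i m * christoffel g m k j y :=
    Finset.sum_congr rfl fun m _ => mul_comm _ _
  rw [h3, h4, h1, h2, hg.pd_symm hy k i j, hg.pd_symm hy i k j, hg.pd_symm hy j k i]
  simp only [Matrix.zero_apply]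
  ring

theorem dirM_metric (hg : IsMetricOn g Ω) (hy : y ∈ Ω) :
    dirM g x y = (connMatrix g x y)ᵀ * g y + g y * connMatrix g x y := by
  have := hg.cov_metric (x := x) hy
  rw [cov₂, sub_sub, sub_eq_zero] at this
  exact this

/-- This is `∇g⁻¹ = 0`, obtained by differentiating `g g⁻¹ = 1` and inserting `∇g = 0`. -/
theorem dirM_inv (hg : IsMetricOn g Ω) (hy : y ∈ Ω) :
    dirM (fun z => (g z)⁻¹) x y
      = -(connMatrix g x y * (g y)⁻¹) - (g y)⁻¹ * (connMatrix g x y)ᵀ := by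
  have h1 : dirM (fun z => g z * (g z)⁻¹) x y = 0 := by
    rw [dirM_congr (G := fun _ => (1 : Tensor2)), dirM_const]
    filter_upwards [hg.isOpen.mem_nhds hy] with z hz
    exact Matrix.mul_nonsing_inv _ (hg.isUnit_det hz)
  rw [dirM_mul hg.isOpen hg.smooth hg.smooth_inv hy, hg.dirM_metric hy] at h1
  have hi := Matrix.nonsing_inv_mul _ (hg.isUnit_det hy)
  have hi' := Matrix.mul_nonsing_inv _ (hg.isUnit_det hy)
  have h2 := congrArg (fun A => (g y)⁻¹ * A) h1
  simp only [Matrix.mul_add, Matrix.add_mul, ← Matrix.mul_assoc, hi, Matrix.one_mul,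
    Matrix.mul_zero] at h2
  simp only [Matrix.mul_assoc, hi', Matrix.mul_one] at h2
  rw [← sub_eq_zero, ← h2]
  abel

theorem smooth_dot (hg : IsMetricOn g Ω) (hF : SmoothM F Ω) (hG : SmoothM G Ω) :
    SmoothM (fun z => dot (g z) (F z) (G z)) Ω :=
  (hF.mul hg.smooth_inv).mul hG

theorem smooth_app (hg : IsMetricOn g Ω) (hF : SmoothM F Ω) (hα : SmoothV α Ω) :
    SmoothV (fun z => app (g z) (F z) (α z)) Ω :=
  hF.mulVec (hg.smooth_inv.mulVec hα)

theorem smooth_cov₂ (hg : IsMetricOn g Ω) (hF : SmoothM F Ω) (x : E4) : SmoothM (cov₂ g F x) Ω :=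
  ((hF.dirM hg.isOpen x).sub ((hg.smooth_connMatrix x).transpose.mul hF)).sub
    (hF.mul (hg.smooth_connMatrix x))

/-- The derivative of the `g⁻¹` inside `dot` supplies exactly the connection terms of the two
contracted indices. -/
theorem cov_dot (hg : IsMetricOn g Ω) (hF : SmoothM F Ω) (hG : SmoothM G Ω) (hy : y ∈ Ω) :
    cov₂ g (fun z => dot (g z) (F z) (G z)) x y
      = dot (g y) (cov₂ g F x y) (G y) + dot (g y) (F y) (cov₂ g G x y) := by
  simp only [cov₂, dot]
  rw [dirM_mul hg.isOpen (hF.mul hg.smooth_inv) hG hy, dirM_mul hg.isOpen hF hg.smooth_inv hy,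
    hg.dirM_inv hy]
  noncomm_ring

theorem cov_app (hg : IsMetricOn g Ω) (hF : SmoothM F Ω) (hα : SmoothV α Ω) (hy : y ∈ Ω) :
    cov₁ g (fun z => app (g z) (F z) (α z)) x y
      = app (g y) (cov₂ g F x y) (α y) + app (g y) (F y) (cov₁ g α x y) := by
  simp only [cov₁, cov₂, app]
  rw [dirV_mulVec hg.isOpen hF (hg.smooth_inv.mulVec hα) hy,
    dirV_mulVec hg.isOpen hg.smooth_inv hα hy, hg.dirM_inv hy]
  simp only [Matrix.mulVec_add, Matrix.mulVec_sub, Matrix.sub_mulVec, Matrix.mulVec_mulVec,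
    Matrix.neg_mulVec, Matrix.mulVec_neg, Matrix.mul_assoc, Matrix.sub_mul]
  abel

theorem cov_sub (hg : IsMetricOn g Ω) (hF : SmoothM F Ω) (hG : SmoothM G Ω) (hy : y ∈ Ω) :
    cov₂ g (fun z => F z - G z) x y = cov₂ g F x y - cov₂ g G x y := by
  simp only [cov₂]
  rw [dirM_sub hg.isOpen hF hG hy]
  noncomm_ring

theorem cov_add (hg : IsMetricOn g Ω) (hF : SmoothM F Ω) (hG : SmoothM G Ω) (hy : y ∈ Ω) :
    cov₂ g (fun z => F z + G z) x y = cov₂ g F x y + cov₂ g G x y := by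
  simp only [cov₂]
  rw [dirM_add hg.isOpen hF hG hy]
  noncomm_ring

theorem cov_smul (hg : IsMetricOn g Ω) (c : ℝ) (hα : SmoothV α Ω) (hy : y ∈ Ω) :
    cov₁ g (fun z => c • α z) x y = c • cov₁ g α x y := by
  simp only [cov₁]
  rw [dirV_smul hg.isOpen c hα hy, Matrix.mulVec_smul, smul_sub]

theorem cov_vecMulVec (hg : IsMetricOn g Ω) (hα : SmoothV α Ω) (hβ : SmoothV β Ω) (hy : y ∈ Ω) :
    cov₂ g (fun z => Matrix.vecMulVec (α z) (β z)) x y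
      = Matrix.vecMulVec (cov₁ g α x y) (β y) + Matrix.vecMulVec (α y) (cov₁ g β x y) := by
  simp only [cov₂, cov₁]
  rw [dirM_vecMulVec hg.isOpen hα hβ hy, Matrix.mul_vecMulVec, Matrix.vecMulVec_mul,
    Matrix.sub_vecMulVec, Matrix.vecMulVec_sub, ← Matrix.mulVec_transpose]
  abel

/-- The covariant derivative of the contraction of a 2-tensor with a constant vector. -/
theorem cov_contract (hg : IsMetricOn g Ω) (hF : SmoothM F Ω) (hy : y ∈ Ω) :
    cov₁ g (fun z => (F z)ᵀ *ᵥ w) x y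
      = (cov₂ g F x y)ᵀ *ᵥ w + (F y)ᵀ *ᵥ (connMatrix g x y *ᵥ w) := by
  simp only [cov₁, cov₂]
  rw [dirV_mulVec hg.isOpen hF.transpose (SmoothV.const _) hy, dirM_transpose]
  have : dirV (fun _ => w.ofLp) x y = 0 := by ext i; simp [dirV]
  rw [this]
  simp only [Matrix.transpose_sub, Matrix.transpose_mul, Matrix.transpose_transpose,
    Matrix.sub_mulVec, Matrix.mulVec_mulVec, Matrix.mulVec_zero]
  abel

/-- The Ricci identity. -/
theorem cov_comm (hg : IsMetricOn g Ω) (hF : SmoothM F Ω) (hy : y ∈ Ω) :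
    cov₂ g (cov₂ g F w) x y - cov₂ g (cov₂ g F x) w y
      = -((curvMatrix g x w y)ᵀ * F y) - F y * curvMatrix g x w y := by
  have h : ∀ x w : E4, dirM (cov₂ g F w) x y = dirM (dirM F w) x y
      - ((dirM (connMatrix g w) x y)ᵀ * F y + (connMatrix g w y)ᵀ * dirM F x y)
      - (dirM F x y * connMatrix g w y + F y * dirM (connMatrix g w) x y) := by
    intro x w
    have hw := hg.smooth_connMatrix w
    change dirM (fun z => dirM F w z - (connMatrix g w z)ᵀ * F z - F z * connMatrix g w z) x y = _
    rw [dirM_sub hg.isOpen ((hF.dirM hg.isOpen w).sub (hw.transpose.mul hF)) (hF.mul hw) hy,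
      dirM_sub hg.isOpen (hF.dirM hg.isOpen w) (hw.transpose.mul hF) hy,
      dirM_mul hg.isOpen hw.transpose hF hy, dirM_mul hg.isOpen hF hw hy, dirM_transpose]
  rw [cov₂.eq_def g (cov₂ g F w), cov₂.eq_def g (cov₂ g F x), h, h,
    -- The directions have constant coordinates, so they commute: second partial derivatives cancel
    -- and no bracket term appears.
    dirM_dirM_comm hg.isOpen hF hy (x := x) (w := w)]
  simp only [cov₂, curvMatrix, Matrix.transpose_add, Matrix.transpose_sub, Matrix.transpose_mul]
  noncomm_ring

theorem curvMatrix_single (g : E4 → Tensor2) (y : E4) (a b c d : Fin 4) :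
    curvMatrix g (EuclideanSpace.single c 1) (EuclideanSpace.single d 1) y a b
      = riemannUp g a b c d y := by
  simp [curvMatrix, riemannUp, dirM, pd, Matrix.mul_apply, connMatrix_single]

theorem curvMatrix_swap : curvMatrix g w x y = -curvMatrix g x w y := by
  simp only [curvMatrix]
  abel

/-- Bilinearity connects curvature along frame vectors with the components `riemannUp`, which are
defined along coordinate vectors. -/
theorem curvMatrix_eq_sum (hg : IsMetricOn g Ω) (hy : y ∈ Ω) (x w : E4) :
    curvMatrix g x w y = ∑ c, ∑ d, (x c * w d) •
      curvMatrix g (EuclideanSpace.single c 1) (EuclideanSpace.single d 1) y := by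
  have hd : ∀ x w : E4, dirM (connMatrix g w) x y
      = ∑ d, w d • dirM (connMatrix g (EuclideanSpace.single d 1)) x y := by
    intro x w
    ext m j
    have h : ∀ k m j, (fun z => connMatrix g (EuclideanSpace.single k 1) z m j)
      = christoffel g m k j := fun k m j => funext fun z => connMatrix_single g k z m j
    have h' : (fun z => connMatrix g w z m j) = fun z => ∑ k, w k * christoffel g m k j z := rfl
    simp only [dirM, Matrix.of_apply, Matrix.sum_apply, Matrix.smul_apply, h, h', smul_eq_mul]
    have hs := fun k => differentiableAt_of_smooth hg.isOpen (hg.smooth_christoffel m k j) hy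
    rw [fderiv_fun_sum fun k _ => (hs k).const_mul _, sum_apply]
    refine Finset.sum_congr rfl fun k _ => ?_
    rw [fderiv_const_mul (hs k)]
    rfl
  have hs : ∀ x w : E4, dirM (connMatrix g w) x y = ∑ c, ∑ d, (x c * w d) •
      dirM (connMatrix g (EuclideanSpace.single d 1)) (EuclideanSpace.single c 1) y := by
    intro x w
    rw [dirM_eq_sum]
    refine Finset.sum_congr rfl fun c _ => ?_
    rw [hd, Finset.smul_sum]
    simp only [smul_smul]
  have hp : ∀ x w : E4, connMatrix g x y * connMatrix g w y = ∑ c, ∑ d, (x c * w d) •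
      (connMatrix g (EuclideanSpace.single c 1) y * connMatrix g (EuclideanSpace.single d 1) y) := by
    intro x w
    rw [connMatrix_eq_sum g x, connMatrix_eq_sum g w, Finset.sum_mul]
    simp only [Matrix.mul_sum, Matrix.smul_mul, Matrix.mul_smul, smul_smul, mul_comm]
  have hc : ∀ f : Fin 4 → Fin 4 → Tensor2,
      ∑ c, ∑ d, (w c * x d) • f c d = ∑ c, ∑ d, (x c * w d) • f d c := by
    intro f
    rw [Finset.sum_comm]
    simp only [mul_comm]
  simp only [curvMatrix, smul_add, smul_sub, Finset.sum_add_distrib, Finset.sum_sub_distrib]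
  rw [hs x w, hs w x, hp x w, hp w x, hc, hc]

/-- The Ricci identity applied to the metric itself: `∇g` vanishes near the point, hence so do its
second derivatives. -/
theorem metric_curvMatrix_antisymm (hg : IsMetricOn g Ω) (hy : y ∈ Ω) :
    (curvMatrix g x w y)ᵀ * g y + g y * curvMatrix g x w y = 0 := by
  have h := hg.cov_comm hg.smooth hy (x := x) (w := w)
  have h0 : ∀ x w : E4, cov₂ g (cov₂ g g w) x y = 0 := by
    intro x w
    rw [cov₂_congr (G := fun _ => (0 : Tensor2))]
    · simp [cov₂, dirM_const]
    · filter_upwards [hg.isOpen.mem_nhds hy] with z hz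
      exact hg.cov_metric hz
  rw [h0, h0, sub_zero] at h
  rw [← neg_eq_zero, h]
  abel

/-- Absence of torsion means `Γ_b c = Γ_c b`, an identity that may also be differentiated. The
derivative terms and the quadratic terms of the cyclic sum then cancel in pairs. -/
theorem curvMatrix_bianchi (hg : IsMetricOn g Ω) (hy : y ∈ Ω) (x w v : E4) :
    curvMatrix g x w y *ᵥ v + curvMatrix g w v y *ᵥ x + curvMatrix g v x y *ᵥ w = 0 := by
  have hd : ∀ a b c : E4, dirM (connMatrix g b) a y *ᵥ c = dirM (connMatrix g c) a y *ᵥ b := by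
    intro a b c
    have h : ∀ b c : E4, dirV (fun z => connMatrix g b z *ᵥ c) a y
        = dirM (connMatrix g b) a y *ᵥ c := by
      intro b c
      rw [dirV_mulVec hg.isOpen (hg.smooth_connMatrix b) (SmoothV.const _) hy]
      have : dirV (fun _ => c.ofLp) a y = 0 := by ext i; simp [dirV]
      rw [this, Matrix.mulVec_zero, add_zero]
    rw [← h, ← h]
    refine dirV_congr ?_
    filter_upwards [hg.isOpen.mem_nhds hy] with z hz
    exact hg.connMatrix_mulVec_comm hz
  have hp : ∀ a b c : E4, (connMatrix g a y * connMatrix g b y) *ᵥ c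
      = (connMatrix g a y * connMatrix g c y) *ᵥ b := by
    intro a b c
    rw [← Matrix.mulVec_mulVec, ← Matrix.mulVec_mulVec,
      hg.connMatrix_mulVec_comm hy (x := b) (w := c)]
  simp only [curvMatrix, Matrix.add_mulVec, Matrix.sub_mulVec]
  rw [hd x w v, hd w x v, hd v w x, hp x w v, hp w x v, hp v w x]
  abel

theorem riemann_eq_curvMatrix (g : E4 → Tensor2) (y : E4) (a b c d : Fin 4) :
    riemann g y a b c d
      = (g y * curvMatrix g (EuclideanSpace.single c 1) (EuclideanSpace.single d 1) y) a b := by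
  simp only [riemann, Matrix.mul_apply, curvMatrix_single]

end IsMetricOn

/-! ### Linear changes of frame -/

/-- The components of a covariant 2-tensor in the frame given by the columns of `B`. -/
def pull (B A : Tensor2) : Tensor2 := Bᵀ * A * B

theorem pull_add (B A C : Tensor2) : pull B (A + C) = pull B A + pull B C := by
  simp only [pull]; noncomm_ring

theorem pull_sub (B A C : Tensor2) : pull B (A - C) = pull B A - pull B C := by
  simp only [pull]; noncomm_ring

theorem pull_neg (B A : Tensor2) : pull B (-A) = -pull B A := by
  simp only [pull]; noncomm_ring

theorem pull_smul (B : Tensor2) (c : ℝ) (A : Tensor2) : pull B (c • A) = c • pull B A := by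
  simp [pull]

theorem pull_zero (B : Tensor2) : pull B 0 = 0 := by simp [pull]

theorem pull_transpose (B A : Tensor2) : pull B Aᵀ = (pull B A)ᵀ := by
  simp [pull, Matrix.mul_assoc]

theorem pull_vecMulVec (B : Tensor2) (x y : Fin 4 → ℝ) :
    pull B (Matrix.vecMulVec x y) = Matrix.vecMulVec (Bᵀ *ᵥ x) (Bᵀ *ᵥ y) := by
  rw [pull, Matrix.mul_vecMulVec, Matrix.vecMulVec_mul, Matrix.mulVec_transpose,
    Matrix.mulVec_transpose]

theorem pull_apply (B A : Tensor2) (a b : Fin 4) :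
    pull B A a b = (fun i => B i a) ⬝ᵥ (A *ᵥ fun i => B i b) := by
  rw [pull, Matrix.mul_assoc, Matrix.mul_apply]
  rfl

theorem pull_sum (B : Tensor2) (A : Fin 4 → Tensor2) :
    pull B (∑ e, A e) = ∑ e, pull B (A e) := by
  simp only [pull, Matrix.mul_sum, Matrix.sum_mul]

theorem pull_eq_sum (B A : Tensor2) (a b : Fin 4) :
    pull B A a b = ∑ i, ∑ j, B i a * B j b * A i j := by
  rw [pull, Matrix.mul_assoc, Matrix.mul_apply]
  refine Finset.sum_congr rfl fun i _ => ?_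
  rw [Matrix.mul_apply, Finset.mul_sum, Matrix.transpose_apply]
  exact Finset.sum_congr rfl fun j _ => by ring

section Invertible

variable {B : Tensor2}

/-- Raising an index in coordinates is raising it in the frame. No invertibility of `A` is needed:
for singular `A` both inverses are zero. -/
theorem pull_inv (hB : IsUnit B.det) (A : Tensor2) : A⁻¹ = B * (pull B A)⁻¹ * Bᵀ := by
  rw [pull, Matrix.mul_inv_rev, Matrix.mul_inv_rev, ← Matrix.mul_assoc,
    Matrix.mul_nonsing_inv _ hB, Matrix.one_mul, Matrix.mul_assoc, Matrix.nonsing_inv_mul,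
    Matrix.mul_one]
  rwa [Matrix.det_transpose]

theorem pull_injective (hB : IsUnit B.det) : Function.Injective (pull B) := by
  intro A C h
  have hB' : IsUnit Bᵀ.det := by rwa [Matrix.det_transpose]
  have := congrArg (fun X => Bᵀ⁻¹ * X * B⁻¹) h
  simpa only [pull, ← Matrix.mul_assoc, Matrix.nonsing_inv_mul _ hB', Matrix.one_mul,
    Matrix.mul_nonsing_inv_cancel_right _ _ hB] using this

theorem pull_dot (hB : IsUnit B.det) (G A C : Tensor2) :
    pull B (dot G A C) = dot (pull B G) (pull B A) (pull B C) := by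
  rw [dot, dot, pull_inv hB G]
  simp only [pull, Matrix.mul_assoc]

theorem mulVec_app (hB : IsUnit B.det) (G A : Tensor2) (x : Fin 4 → ℝ) :
    Bᵀ *ᵥ app G A x = app (pull B G) (pull B A) (Bᵀ *ᵥ x) := by
  rw [app, app, pull_inv hB G]
  simp only [pull, Matrix.mul_assoc, Matrix.mulVec_mulVec]

theorem contract_pull (hB : IsUnit B.det) (G A : Tensor2) (x y : Fin 4 → ℝ) :
    contract G A x y = contract (pull B G) (pull B A) (Bᵀ *ᵥ x) (Bᵀ *ᵥ y) := by
  have h : ∀ x, G⁻¹ *ᵥ x = B *ᵥ ((pull B G)⁻¹ *ᵥ (Bᵀ *ᵥ x)) := by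
    intro x
    rw [pull_inv hB G, Matrix.mulVec_mulVec, Matrix.mulVec_mulVec, Matrix.mul_assoc]
  have k : ∀ s t, (B *ᵥ s) ⬝ᵥ (A *ᵥ (B *ᵥ t)) = s ⬝ᵥ (pull B A *ᵥ t) := by
    intro s t
    rw [pull, ← Matrix.mulVec_mulVec, ← Matrix.mulVec_mulVec, Matrix.dotProduct_mulVec s,
      Matrix.vecMul_transpose]
  rw [contract, contract, h x, h y, k]

end Invertible

/-- Cyclicity of the trace. Since `g⁻¹ = B (pull B g)⁻¹ Bᵀ`, every metric contraction in coordinates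
becomes one in the frame. -/
theorem sum_mul_pull (B C D : Tensor2) :
    ∑ i, ∑ j, (B * C * Bᵀ) i j * D i j = ∑ a, ∑ b, C a b * pull B D a b := by
  have h : ∀ A E : Tensor2, ∑ i, ∑ j, A i j * E i j = (Aᵀ * E).trace := by
    intro A E
    simp only [Matrix.trace, Matrix.diag, Matrix.mul_apply, Matrix.transpose_apply]
    exact Finset.sum_comm
  rw [h, h, pull, Matrix.transpose_mul, Matrix.transpose_mul, Matrix.transpose_transpose,
    Matrix.mul_assoc, Matrix.trace_mul_comm]
  simp only [Matrix.mul_assoc]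

/-! ### Frame changes of 4-tensors, the Riemann tensor and its trace. -/

/-- The action of a matrix on the four indices of a 4-tensor. -/
def act (A : Tensor2) (t : Fin 4 → Fin 4 → Fin 4 → Fin 4 → ℝ) (i j k l : Fin 4) : ℝ :=
  ∑ a, ∑ b, ∑ c, ∑ d, A i a * A j b * A k c * A l d * t a b c d

theorem totalProj_eq_act (G P : Tensor2) (t : Fin 4 → Fin 4 → Fin 4 → Fin 4 → ℝ) :
    totalProj G P t = act (P * G⁻¹) t := rfl

/-- Grouping indices in pairs turns a 4-tensor into a 16 by 16 matrix acted on by congruence, so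
composition follows from the mixed-product rule for Kronecker products. -/
theorem act_eq_kronecker (A : Tensor2) (t : Fin 4 → Fin 4 → Fin 4 → Fin 4 → ℝ) (i j k l : Fin 4) :
    act A t i j k l = (Matrix.kronecker A A
      * Matrix.of (fun p q : Fin 4 × Fin 4 => t p.1 p.2 q.1 q.2)
      * (Matrix.kronecker A A)ᵀ) (i, j) (k, l) := by
  rw [Matrix.mul_assoc]
  simp only [act, Matrix.mul_apply, Fintype.sum_prod_type, Matrix.kronecker,
    Matrix.kroneckerMap_apply, Matrix.transpose_apply, Matrix.of_apply, Finset.mul_sum]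
  refine Finset.sum_congr rfl fun a _ => Finset.sum_congr rfl fun b _ =>
    Finset.sum_congr rfl fun c _ => Finset.sum_congr rfl fun d _ => by ring

theorem act_act (A C : Tensor2) (t : Fin 4 → Fin 4 → Fin 4 → Fin 4 → ℝ) :
    act A (act C t) = act (A * C) t := by
  funext i j k l
  have h : (Matrix.of fun p q : Fin 4 × Fin 4 => act C t p.1 p.2 q.1 q.2)
      = Matrix.kronecker C C * Matrix.of (fun p q : Fin 4 × Fin 4 => t p.1 p.2 q.1 q.2)
        * (Matrix.kronecker C C)ᵀ := by
    ext p q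
    exact act_eq_kronecker C t _ _ _ _
  rw [act_eq_kronecker, act_eq_kronecker, h]
  simp only [Matrix.kronecker]
  rw [Matrix.mul_kronecker_mul, Matrix.transpose_mul]
  simp only [Matrix.mul_assoc]

theorem act_one (t : Fin 4 → Fin 4 → Fin 4 → Fin 4 → ℝ) : act 1 t = t := by
  funext i j k l
  simp [act, Matrix.one_apply]

theorem act_diagonal (π : Fin 4 → ℝ) (t : Fin 4 → Fin 4 → Fin 4 → Fin 4 → ℝ) (i j k l : Fin 4) :
    act (Matrix.diagonal π) t i j k l = π i * π j * π k * π l * t i j k l := by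
  simp [act, Matrix.diagonal_apply]

theorem act_injective {B : Tensor2} (hB : IsUnit B.det) : Function.Injective (act B) := by
  intro s t h
  have := congrArg (act B⁻¹) h
  rwa [act_act, act_act, Matrix.nonsing_inv_mul _ hB, act_one, act_one] at this

theorem act_transpose_mul (B F : Tensor2) (c : ℝ) :
    act Bᵀ (fun i j k l => c * (F i j * F k l))
      = fun a b c' d => c * (pull B F a b * pull B F c' d) := by
  funext a b c' d
  rw [mul_comm (pull B F a b), pull_eq_sum, pull_eq_sum]
  simp only [act, Matrix.transpose_apply, Finset.sum_mul, Finset.mul_sum]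
  refine Finset.sum_congr rfl fun i _ => Finset.sum_congr rfl fun j _ =>
    Finset.sum_congr rfl fun k _ => Finset.sum_congr rfl fun l _ => by ring

theorem act_transpose_riemann {g : E4 → Tensor2} {Ω : Set E4} {y : E4} (hg : IsMetricOn g Ω)
    (hy : y ∈ Ω) (B : Tensor2) (a b c d : Fin 4) :
    act Bᵀ (riemann g y) a b c d = pull B (g y * curvMatrix g (WithLp.toLp 2 fun i => B i c)
      (WithLp.toLp 2 fun i => B i d) y) a b := by
  rw [hg.curvMatrix_eq_sum hy, pull_eq_sum]
  refine Finset.sum_congr rfl fun i _ => Finset.sum_congr rfl fun j _ => ?_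
  simp only [Matrix.mul_smul, Matrix.sum_apply, Matrix.smul_apply, smul_eq_mul,
    Finset.mul_sum, Matrix.transpose_apply, IsMetricOn.riemann_eq_curvMatrix]
  exact Finset.sum_congr rfl fun k _ => Finset.sum_congr rfl fun l _ => by ring

theorem sum_comm₄ (f : Fin 4 → Fin 4 → Fin 4 → Fin 4 → ℝ) :
    ∑ i, ∑ j, ∑ k, ∑ l, f i j k l = ∑ k, ∑ l, ∑ i, ∑ j, f i j k l := by
  have h := Finset.sum_comm (s := Finset.univ) (t := Finset.univ)
    (f := fun p q : Fin 4 × Fin 4 => f p.1 p.2 q.1 q.2)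
  simpa only [Fintype.sum_prod_type] using h

/-- The Ricci tensor as a trace of the curvature operator. -/
theorem pull_ricci {g : E4 → Tensor2} {Ω : Set E4} {y : E4} (hg : IsMetricOn g Ω)
    (hy : y ∈ Ω) {B : Tensor2} (hB : IsUnit B.det) (b d : Fin 4) :
    pull B (ricci g y) b d
      = ∑ c, ∑ a, (pull B (g y))⁻¹ c a * act Bᵀ (riemann g y) a b c d := by
  -- The trace of the mixed curvature is rewritten with `g⁻¹` and the fully covariant tensor, the
  -- form that transforms under `act`.
  have hR : ∀ j l, ricci g y j l = ∑ k, ∑ i, (g y)⁻¹ k i * riemann g y i j k l := by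
    intro j l
    simp only [ricci, Matrix.of_apply]
    refine Finset.sum_congr rfl fun k _ => ?_
    have h := congrFun (congrFun (Matrix.nonsing_inv_mul_cancel_left (g y)
      (curvMatrix g (EuclideanSpace.single k 1) (EuclideanSpace.single l 1) y)
      (hg.isUnit_det hy)) k) j
    rw [Matrix.mul_apply, IsMetricOn.curvMatrix_single] at h
    simp only [IsMetricOn.riemann_eq_curvMatrix, h]
  have hA : ∀ a c, act Bᵀ (riemann g y) a b c d
      = pull B (Matrix.of fun i k => ∑ j, ∑ l, B j b * B l d * riemann g y i j k l) a c := by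
    intro a c
    rw [pull_eq_sum]
    simp only [act, Matrix.of_apply, Matrix.transpose_apply, Finset.mul_sum]
    refine Finset.sum_congr rfl fun i _ => ?_
    rw [Finset.sum_comm]
    refine Finset.sum_congr rfl fun k _ => Finset.sum_congr rfl fun j _ =>
      Finset.sum_congr rfl fun l _ => by ring
  have hI := pull_inv hB (g y)
  simp only [hA]
  have hT : ∀ (C D : Tensor2), ∑ c, ∑ a, C c a * D a c = ∑ c, ∑ a, C c a * Dᵀ c a :=
    fun C D => rfl
  rw [hT, ← pull_transpose, ← sum_mul_pull, ← hI, pull_eq_sum]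
  simp only [hR, Matrix.transpose_apply, Matrix.of_apply, Finset.mul_sum]
  rw [sum_comm₄]
  refine Finset.sum_congr rfl fun k _ => Finset.sum_congr rfl fun i _ =>
    Finset.sum_congr rfl fun j _ => Finset.sum_congr rfl fun l _ => by ring

/-- The frame vector given by the column `a` of `B`. -/
def frameVec (B : Tensor2) (a : Fin 4) : E4 := WithLp.toLp 2 fun i => B i a

theorem frameVec_ofLp (B : Tensor2) (a : Fin 4) :
    (frameVec B a).ofLp = B *ᵥ Pi.single a 1 := by
  ext i
  simp [frameVec]

/-! ### The second fundamental form in an arbitrary frame. -/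

namespace IsMetricOn

variable {g P : E4 → Tensor2} {Ω : Set E4} {y : E4}

/-- In `∇(P w)` the part `P (∇w)` is killed by `1 - P`, because `P` is idempotent. Only the
derivative of the projector survives, so umbilicity becomes a condition on `∇P`. -/
theorem secondForm_eq (hg : IsMetricOn g Ω) (hP : SmoothM P Ω)
    (hPP : ∀ z ∈ Ω, dot (g z) (P z) (P z) = P z) (hy : y ∈ Ω) (i j k : Fin 4) :
    secondForm g P y i j k = ∑ a, ((g y)⁻¹ * P y) a i *
      ((1 - (g y)⁻¹ * P y) * (g y)⁻¹ * cov₂ g P (EuclideanSpace.single a 1) y) k j := by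
  have hpd : ∀ a, dirM (fun z => (g z)⁻¹ * P z) (EuclideanSpace.single a 1) y
      + connMatrix g (EuclideanSpace.single a 1) y * ((g y)⁻¹ * P y)
      = (g y)⁻¹ * cov₂ g P (EuclideanSpace.single a 1) y
        + (g y)⁻¹ * P y * connMatrix g (EuclideanSpace.single a 1) y := by
    intro a
    rw [dirM_mul hg.isOpen hg.smooth_inv hP hy, hg.dirM_inv hy, cov₂]
    noncomm_ring
  have h0 : (1 - (g y)⁻¹ * P y) * ((g y)⁻¹ * P y) = 0 := by
    have h := hPP y hy
    rw [dot] at h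
    rw [Matrix.sub_mul, Matrix.one_mul, Matrix.mul_assoc, ← Matrix.mul_assoc (P y), h, sub_self]
  have h1 : ∀ a, (1 - (g y)⁻¹ * P y) * (g y)⁻¹ * cov₂ g P (EuclideanSpace.single a 1) y
      = (1 - (g y)⁻¹ * P y) * (dirM (fun z => (g z)⁻¹ * P z) (EuclideanSpace.single a 1) y
      + connMatrix g (EuclideanSpace.single a 1) y * ((g y)⁻¹ * P y)) := by
    intro a
    rw [hpd, Matrix.mul_add, ← Matrix.mul_assoc _ ((g y)⁻¹ * P y), h0, Matrix.zero_mul, add_zero,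
      Matrix.mul_assoc]
  simp only [h1, secondForm]
  generalize 1 - (g y)⁻¹ * P y = A
  rw [Finset.sum_comm]
  refine Finset.sum_congr rfl fun a _ => ?_
  rw [Matrix.mul_apply (M := A), Finset.mul_sum]
  refine Finset.sum_congr rfl fun l _ => ?_
  rw [Matrix.add_apply, Matrix.mul_apply (M := connMatrix g _ _)]
  simp only [connMatrix_single, dirM, pd, Matrix.of_apply]
  ring

/-- Umbilicity of a plane field, in an arbitrary frame. -/
theorem umbilical_pull (hg : IsMetricOn g Ω) (hP : SmoothM P Ω)
    (hPP : ∀ z ∈ Ω, dot (g z) (P z) (P z) = P z) (hy : y ∈ Ω) {B : Tensor2} (hB : IsUnit B.det)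
    (hu : IsUmbilicalAt g P y) (c : Fin 4) (N : Tensor2)
    (hN : ∀ a b, N a b = ∑ m, ((pull B (g y))⁻¹ * pull B (P y)) m a *
      ((1 - pull B (P y) * (pull B (g y))⁻¹) * pull B (cov₂ g P (frameVec B m) y)) c b)
    (a b : Fin 4) :
    N a b + N b a
      = pull B (P y) a b * ((1 / 2) * ∑ i, ∑ j, (pull B (g y))⁻¹ i j * (N i j + N j i)) := by
  -- The vector-valued form is paired with the metric dual of the frame vector `c`, which leaves an
  -- ordinary 2-tensor to transform. Its symmetrization is twice the paired `symForm`.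
  set M : Tensor2 := Matrix.of fun i j => ∑ k, (g y * B) k c * secondForm g P y i j k with hM
  have h1 : M + Mᵀ = ((1 / 2) * ∑ i, ∑ j, (g y)⁻¹ i j * (M + Mᵀ) i j) • P y := by
    ext i j
    have h := fun k => hu i j k
    simp only [Matrix.add_apply, Matrix.transpose_apply, Matrix.smul_apply, smul_eq_mul, hM,
      Matrix.of_apply]
    have e1 : ∀ i j, ∑ k, (g y * B) k c * secondForm g P y i j k
        + ∑ k, (g y * B) k c * secondForm g P y j i k
        = 2 * ∑ k, (g y * B) k c * symForm g P y i j k := by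
      intro i j
      rw [← Finset.sum_add_distrib, Finset.mul_sum]
      exact Finset.sum_congr rfl fun k _ => by rw [symForm]; ring
    simp only [e1]
    have e2 : ∀ k, symForm g P y i j k = (1 / 2) * P y i j * traceForm g P y k :=
      fun k => sub_eq_zero.1 (h k)
    have e3 : ∑ i, ∑ j, (g y)⁻¹ i j * (2 * ∑ k, (g y * B) k c * symForm g P y i j k)
        = 2 * ∑ k, (g y * B) k c * traceForm g P y k := by
      simp only [traceForm, Finset.mul_sum]
      rw [Finset.sum_comm_cycle]
      refine Finset.sum_congr rfl fun k _ => Finset.sum_congr rfl fun i _ =>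
        Finset.sum_congr rfl fun j _ => by ring
    rw [e3]
    simp only [e2, Finset.mul_sum, Finset.sum_mul]
    exact Finset.sum_congr rfl fun k _ => by ring
  have hI := pull_inv hB (g y)
  have hMN : pull B M = N := by
    set X : Fin 4 → Tensor2 := fun e => (1 - (g y)⁻¹ * P y) * (g y)⁻¹
      * cov₂ g P (EuclideanSpace.single e 1) y with hX
    have e1 : M = ∑ e, Matrix.vecMulVec (((g y)⁻¹ * P y) e) (((g y * B)ᵀ * X e) c) := by
      ext i j
      simp only [hM, Matrix.of_apply, Matrix.sum_apply, Matrix.vecMulVec_apply,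
        hg.secondForm_eq hP hPP hy]
      simp only [Matrix.mul_apply (M := (g y * B)ᵀ), Finset.mul_sum, Matrix.transpose_apply]
      rw [Finset.sum_comm]
      exact Finset.sum_congr rfl fun e _ => Finset.sum_congr rfl fun k _ => by rw [hX]; ring
    have e2 : ∀ e, (g y * B)ᵀ * X e * B = (1 - pull B (P y) * (pull B (g y))⁻¹)
        * pull B (cov₂ g P (EuclideanSpace.single e 1) y) := by
      intro e
      have e3 : (g y * B)ᵀ * ((1 - (g y)⁻¹ * P y) * (g y)⁻¹)
          = (1 - pull B (P y) * (pull B (g y))⁻¹) * Bᵀ := by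
        have e4 : g y * ((1 - (g y)⁻¹ * P y) * (g y)⁻¹) = 1 - P y * (g y)⁻¹ := by
          rw [← Matrix.mul_assoc, Matrix.mul_sub, ← Matrix.mul_assoc,
            Matrix.mul_nonsing_inv _ (hg.isUnit_det hy), Matrix.sub_mul, Matrix.mul_one,
            Matrix.mul_nonsing_inv _ (hg.isUnit_det hy), Matrix.one_mul]
        rw [Matrix.transpose_mul, hg.symm y hy, Matrix.mul_assoc, e4, hI]
        simp only [pull]
        noncomm_ring
      rw [hX, ← Matrix.mul_assoc, e3]
      simp only [pull, Matrix.mul_assoc]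
    ext a b
    have e5 : ∀ e, (Bᵀ *ᵥ ((g y)⁻¹ * P y) e) a
        = ∑ m, B e m * ((pull B (g y))⁻¹ * pull B (P y)) m a := by
      intro e
      have : (g y)⁻¹ * P y * B = B * ((pull B (g y))⁻¹ * pull B (P y)) := by
        rw [hI]
        simp only [pull, Matrix.mul_assoc]
      rw [← Matrix.mul_apply, ← this, Matrix.mul_apply, Matrix.mulVec, dotProduct]
      exact Finset.sum_congr rfl fun k _ => mul_comm _ _
    have e6 : ∀ e, (Bᵀ *ᵥ ((g y * B)ᵀ * X e) c) b = ((g y * B)ᵀ * X e * B) c b := by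
      intro e
      rw [Matrix.mul_apply, Matrix.mulVec, dotProduct]
      exact Finset.sum_congr rfl fun k _ => mul_comm _ _
    have e7 : ∀ m, pull B (cov₂ g P (frameVec B m) y)
        = ∑ e, B e m • pull B (cov₂ g P (EuclideanSpace.single e 1) y) := by
      intro m
      rw [cov₂_eq_sum]
      simp only [pull, Matrix.mul_sum, Matrix.sum_mul, Matrix.mul_smul, Matrix.smul_mul, frameVec]
    rw [hN, e1, pull_sum]
    simp only [e7, Matrix.mul_smul, Matrix.sum_apply, Matrix.smul_apply, ← e2,
      pull_vecMulVec, Matrix.vecMulVec_apply, e5, e6, Finset.sum_mul, Finset.mul_sum, smul_eq_mul]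
    rw [Finset.sum_comm]
    exact Finset.sum_congr rfl fun m _ => Finset.sum_congr rfl fun e _ => by ring
  have h2 := congrArg (pull B) h1
  rw [pull_add, pull_transpose, pull_smul, hI, sum_mul_pull, pull_add, pull_transpose, hMN] at h2
  have h3 := congrFun (congrFun h2 a) b
  simp only [Matrix.add_apply, Matrix.transpose_apply, Matrix.smul_apply, smul_eq_mul] at h3
  rw [h3]
  ring

end IsMetricOn

/-! ### Adapted orthonormal frames -/

/-- The components of the metric in an orthonormal frame. -/
def minkowski : Tensor2 := Matrix.diagonal ![-1, 1, 1, 1]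

/-- The components of the canonical 2-form in an adapted frame. -/
def frameU : Tensor2 := !![0, 1, 0, 0; -1, 0, 0, 0; 0, 0, 0, 0; 0, 0, 0, 0]

/-- The components of the dual of the canonical 2-form in an adapted frame. -/
def frameW : Tensor2 := !![0, 0, 0, 0; 0, 0, 0, 0; 0, 0, 0, 1; 0, 0, -1, 0]

theorem minkowski_mul_self : minkowski * minkowski = 1 := by
  rw [minkowski, Matrix.diagonal_mul_diagonal, ← Matrix.diagonal_one]
  congr 1
  ext i
  fin_cases i <;> simp

theorem minkowski_inv : minkowski⁻¹ = minkowski := Matrix.inv_eq_left_inv minkowski_mul_self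

theorem minkowski_apply (i j : Fin 4) :
    minkowski i j = if i = j then ![-1, 1, 1, 1] i else 0 := by
  rw [minkowski, Matrix.diagonal_apply]

theorem dot_minkowski_apply (A C : Tensor2) (i j : Fin 4) :
    dot minkowski A C i j = -(A i 0 * C 0 j) + A i 1 * C 1 j + A i 2 * C 2 j + A i 3 * C 3 j := by
  rw [dot, minkowski_inv, minkowski, Matrix.mul_apply, Fin.sum_univ_four]
  simp [Matrix.mul_diagonal]

theorem app_minkowski_apply (A : Tensor2) (x : Fin 4 → ℝ) (i : Fin 4) :
    app minkowski A x i = -(A i 0 * x 0) + A i 1 * x 1 + A i 2 * x 2 + A i 3 * x 3 := by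
  rw [app, minkowski_inv, minkowski, Matrix.mulVec, dotProduct, Fin.sum_univ_four]
  simp [Matrix.mulVec_diagonal]

/-- The projectors in an adapted frame. -/
theorem dot_frameU : dot minkowski frameU frameU = Matrix.diagonal ![-1, 1, 0, 0] := by
  ext i j
  rw [dot_minkowski_apply]
  fin_cases i <;> fin_cases j <;> simp [frameU]

theorem minkowski_sub_dot_frameU :
    minkowski - dot minkowski frameU frameU = Matrix.diagonal ![0, 0, 1, 1] := by
  rw [dot_frameU, minkowski, Matrix.diagonal_sub]
  congr 1
  ext i
  fin_cases i <;> simp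

/-- The frame components of a 2-form whose only components mix the two planes. -/
def mixedForm (p q r s : ℝ) : Tensor2 :=
  !![0, 0, p, q; 0, 0, r, s; -p, -r, 0, 0; -q, -s, 0, 0]

/-- The frame components of `∇U` for an umbilical structure. -/
def frameDU (Φ Ψ : Fin 4 → ℝ) (a : Fin 4) : Tensor2 :=
  mixedForm (![-Ψ 3 / 2, Φ 2 / 2, -Φ 1 / 2, -Ψ 0 / 2] a) (![Ψ 2 / 2, Φ 3 / 2, Ψ 0 / 2, -Φ 1 / 2] a)
    (![-Φ 2 / 2, Ψ 3 / 2, -Φ 0 / 2, -Ψ 1 / 2] a) (![-Φ 3 / 2, -Ψ 2 / 2, Ψ 1 / 2, -Φ 0 / 2] a)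

/-- The frame components of `∇*U` for an umbilical structure. -/
def frameDW (Φ Ψ : Fin 4 → ℝ) (a : Fin 4) : Tensor2 :=
  mixedForm (![-Φ 3 / 2, -Ψ 2 / 2, Ψ 1 / 2, -Φ 0 / 2] a) (![Φ 2 / 2, -Ψ 3 / 2, Φ 0 / 2, Ψ 1 / 2] a)
    (![Ψ 2 / 2, Φ 3 / 2, Ψ 0 / 2, -Φ 1 / 2] a) (![Ψ 3 / 2, -Φ 2 / 2, Φ 1 / 2, Ψ 0 / 2] a)

/-- The derivatives of `U` and `*U` have only components mixing the two planes, and the former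
determines the latter. -/
theorem mixed_of_relations {X Y : Tensor2} (hX : Xᵀ = -X) (hY : Yᵀ = -Y)
    (h1 : X = dot minkowski (dot minkowski X frameU + dot minkowski frameU X) frameU
      + dot minkowski (dot minkowski frameU frameU) X)
    (h2 : dot minkowski Y frameW + dot minkowski frameW Y
      = dot minkowski X frameU + dot minkowski frameU X)
    (h3 : dot minkowski X frameW + dot minkowski frameU Y = 0) :
    X = mixedForm (X 0 2) (X 0 3) (X 1 2) (X 1 3) ∧
      Y = mixedForm (X 1 3) (-X 1 2) (X 0 3) (-X 0 2) := by
  have hX' := fun i j => congrFun (congrFun hX i) j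
  have hY' := fun i j => congrFun (congrFun hY i) j
  have h1' := fun i j => congrFun (congrFun h1 i) j
  have h2' := fun i j => congrFun (congrFun h2 i) j
  have h3' := fun i j => congrFun (congrFun h3 i) j
  simp only [Matrix.transpose_apply, Matrix.neg_apply] at hX' hY'
  simp only [Matrix.add_apply, Matrix.zero_apply, dot_minkowski_apply] at h1' h2' h3'
  -- `h1` removes the pure components `X 0 1` and `X 2 3`, `h2` removes `Y 2 3`, and `h3` removes `Y
  -- 0 1` and expresses the mixed components of `Y` through those of `X`.
  have a01 := h1' 0 1
  have a23 := h1' 2 3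
  have b23 := h2' 2 2
  have c00 := h3' 0 0
  have c02 := h3' 0 2
  have c03 := h3' 0 3
  have c12 := h3' 1 2
  have c13 := h3' 1 3
  simp [frameU, frameW] at a01 a23 b23 c00 c02 c03 c12 c13
  have X01 := hX' 0 1
  have Y23 := hY' 2 3
  rw [mixedForm, mixedForm]
  constructor <;> ext i j
  · have := hX' i j
    have := hX' i i
    fin_cases i <;> fin_cases j <;> simp at * <;> linarith
  · have := hY' i j
    have := hY' i i
    fin_cases i <;> fin_cases j <;> simp at * <;> linarith

/-- The second fundamental form, contracted with the frame covector `c`, of the plane field with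
projector `P` in an orthonormal frame. -/
def frameSecondForm (P : Tensor2) (DP : Fin 4 → Tensor2) (c : Fin 4) : Tensor2 :=
  Matrix.of fun a b => ∑ m, (minkowski * P) m a * ((1 - P * minkowski) * DP m) c b

/-- Umbilicity in an orthonormal frame. -/
def IsFrameUmbilical (P : Tensor2) (DP : Fin 4 → Tensor2) : Prop :=
  ∀ c a b, frameSecondForm P DP c a b + frameSecondForm P DP c b a
    = P a b * ((1 / 2) * ∑ i, ∑ j, minkowski i j *
      (frameSecondForm P DP c i j + frameSecondForm P DP c j i))

/-- The codifferential of a 2-form in an orthonormal frame. -/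
def frameCodiff (X : Fin 4 → Tensor2) (c : Fin 4) : ℝ :=
  -∑ a, ∑ b, minkowski a b * X a b c

theorem frameCodiff_eq (X : Fin 4 → Tensor2) (c : Fin 4) :
    frameCodiff X c = X 0 0 c - X 1 1 c - X 2 2 c - X 3 3 c := by
  simp [frameCodiff, minkowski_apply, Fin.sum_univ_four]
  ring

theorem frameSecondForm_diagonal (s : Fin 4 → ℝ) (DP : Fin 4 → Tensor2) (c a b : Fin 4) :
    frameSecondForm (Matrix.diagonal s) DP c a b
      = ![-1, 1, 1, 1] a * s a * ((1 - s c * ![-1, 1, 1, 1] c) * DP a c b) := by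
  have h : (1 : Tensor2) - Matrix.diagonal s * minkowski
      = Matrix.diagonal fun i => 1 - s i * ![-1, 1, 1, 1] i := by
    rw [minkowski, Matrix.diagonal_mul_diagonal, ← Matrix.diagonal_one, Matrix.diagonal_sub]
  rw [frameSecondForm, h, minkowski, Matrix.diagonal_mul_diagonal]
  simp [Matrix.diagonal_apply, Matrix.diagonal_mul]

/-- For a normal index `c` the complementary projector acts as the identity. The condition therefore
reads directly on entries of `DP`: the off-diagonal part vanishes, and each diagonal entry carries
its share of the trace. -/
theorem frameUmbilical_diagonal {s : Fin 4 → ℝ} {DP : Fin 4 → Tensor2}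
    (h : IsFrameUmbilical (Matrix.diagonal s) DP) (c : Fin 4) (hc : s c = 0) :
    (∀ a b, a ≠ b → ![-1, 1, 1, 1] a * s a * DP a c b + ![-1, 1, 1, 1] b * s b * DP b c a = 0) ∧
    ∀ a, 2 * (![-1, 1, 1, 1] a * s a * DP a c a) = s a * (s 0 * DP 0 c 0 + s 1 * DP 1 c 1
      + s 2 * DP 2 c 2 + s 3 * DP 3 c 3) := by
  refine ⟨fun a b hab => ?_, fun a => ?_⟩
  · have := h c a b
    simpa [frameSecondForm_diagonal, hc, Matrix.diagonal_apply, hab] using this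
  · have := h c a a
    simp [frameSecondForm_diagonal, hc, minkowski_apply, Fin.sum_univ_four] at this
    linarith

/-- In an adapted frame, umbilicity and the expansion and rotation vectors determine `∇U`. -/
theorem frame_structure_equations {X Y : Fin 4 → Tensor2} {Φ Ψ : Fin 4 → ℝ}
    {p q r s : Fin 4 → ℝ}
    (hX : X = fun a => mixedForm (p a) (q a) (r a) (s a))
    (hY : Y = fun a => mixedForm (s a) (-r a) (q a) (-p a))
    (hV : IsFrameUmbilical (dot minkowski frameU frameU)
      fun m => dot minkowski (X m) frameU + dot minkowski frameU (X m))
    (hH : IsFrameUmbilical (minkowski - dot minkowski frameU frameU)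
      fun m => -(dot minkowski (X m) frameU + dot minkowski frameU (X m)))
    (hΦ : Φ = app minkowski frameW (frameCodiff Y) - app minkowski frameU (frameCodiff X))
    (hΨ : Ψ = app minkowski frameW (frameCodiff X) + app minkowski frameU (frameCodiff Y)) :
    X = frameDU Φ Ψ ∧ Y = frameDW Φ Ψ := by
  rw [dot_frameU] at hV
  rw [minkowski_sub_dot_frameU] at hH
  obtain ⟨v2, v2'⟩ := frameUmbilical_diagonal hV 2 rfl
  obtain ⟨v3, v3'⟩ := frameUmbilical_diagonal hV 3 rfl
  obtain ⟨h0, h0'⟩ := frameUmbilical_diagonal hH 0 rfl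
  obtain ⟨h1, h1'⟩ := frameUmbilical_diagonal hH 1 rfl
  -- A symmetric traceless form on a plane has two components and each plane has two normal
  -- directions: eight equations. The eight components of `Φ` and `Ψ` below complete a linear system
  -- for the sixteen values of `p, q, r, s`.
  have v2 := v2 0 1 (by decide)
  have v3 := v3 0 1 (by decide)
  have h0 := h0 2 3 (by decide)
  have h1 := h1 2 3 (by decide)
  have v2' := v2' 0
  have v3' := v3' 0
  have h0' := h0' 2
  have h1' := h1' 2
  have f := fun i => congrFun hΦ i
  have k := fun i => congrFun hΨ i
  simp only [Pi.sub_apply, Pi.add_apply, app_minkowski_apply, frameCodiff_eq] at f k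
  have f0 := f 0
  have f1 := f 1
  have f2 := f 2
  have f3 := f 3
  have k0 := k 0
  have k1 := k 1
  have k2 := k 2
  have k3 := k 3
  clear f k hΦ hΨ hV hH
  simp [dot_minkowski_apply, frameU, hX, mixedForm] at v2 v3 h0 h1 v2' v3' h0' h1'
  simp [frameU, frameW, hX, hY, mixedForm] at f0 f1 f2 f3 k0 k1 k2 k3
  have hp : p = ![-Ψ 3 / 2, Φ 2 / 2, -Φ 1 / 2, -Ψ 0 / 2] := by
    ext a
    fin_cases a <;> simp <;> linarith
  have hq : q = ![Ψ 2 / 2, Φ 3 / 2, Ψ 0 / 2, -Φ 1 / 2] := by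
    ext a
    fin_cases a <;> simp <;> linarith
  have hr : r = ![-Φ 2 / 2, Ψ 3 / 2, -Φ 0 / 2, -Ψ 1 / 2] := by
    ext a
    fin_cases a <;> simp <;> linarith
  have hs : s = ![-Φ 3 / 2, -Ψ 2 / 2, Ψ 1 / 2, -Φ 0 / 2] := by
    ext a
    fin_cases a <;> simp <;> linarith
  constructor
  · rw [hX, hp, hq, hr, hs]
    rfl
  · rw [hY, hp, hq, hr, hs]
    funext a
    fin_cases a <;> simp [frameDW, neg_div]

/-! ### The structure equations in tensorial form, and their derivative. -/

/-- The 2-form `α ∧ β`. -/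
def wedge (α β : Fin 4 → ℝ) : Tensor2 := Matrix.vecMulVec α β - Matrix.vecMulVec β α

theorem wedge_apply (α β : Fin 4 → ℝ) (i j : Fin 4) : wedge α β i j = α i * β j - β i * α j := rfl

theorem pull_wedge (B : Tensor2) (α β : Fin 4 → ℝ) :
    pull B (wedge α β) = wedge (Bᵀ *ᵥ α) (Bᵀ *ᵥ β) := by
  rw [wedge, pull_sub, pull_vecMulVec, pull_vecMulVec, wedge]

theorem wedge_mulVec_eq_sum (A : Tensor2) (w β : Fin 4 → ℝ) :
    wedge (A *ᵥ w) β = ∑ a, w a • wedge (A *ᵥ Pi.single a 1) β := by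
  ext i j
  simp only [wedge_apply, Matrix.sum_apply, Matrix.smul_apply, smul_eq_mul, Matrix.mulVec_single_one,
    Matrix.col_apply]
  rw [Matrix.mulVec, Matrix.mulVec, dotProduct, dotProduct, Finset.sum_mul, Finset.mul_sum,
    ← Finset.sum_sub_distrib]
  exact Finset.sum_congr rfl fun a _ => by ring

/-- The derivative `∇_w U` of the canonical 2-form `A` (with dual `C`) of an umbilical structure, in
terms of the expansion and rotation vectors. -/
def twist (G A C : Tensor2) (Φ Ψ w : Fin 4 → ℝ) : Tensor2 :=
  wedge (Aᵀ *ᵥ w) ((-(1 / 2) : ℝ) • app G (G - dot G A A) Φ)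
    + wedge ((dot G A A)ᵀ *ᵥ w) ((1 / 2 : ℝ) • app G C Ψ)
    + wedge (Cᵀ *ᵥ w) ((-(1 / 2) : ℝ) • app G (dot G A A) Ψ)
    + wedge ((G - dot G A A)ᵀ *ᵥ w) ((1 / 2 : ℝ) • app G A Φ)

/-- The covariant derivative of `twist`. -/
def covTwist (G A C DA DC : Tensor2) (Φ Ψ DΦ DΨ w : Fin 4 → ℝ) : Tensor2 :=
  wedge (DAᵀ *ᵥ w) ((-(1 / 2) : ℝ) • app G (G - dot G A A) Φ)
    + wedge (Aᵀ *ᵥ w) ((-(1 / 2) : ℝ) •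
        (app G (-(dot G DA A + dot G A DA)) Φ + app G (G - dot G A A) DΦ))
    + (wedge ((dot G DA A + dot G A DA)ᵀ *ᵥ w) ((1 / 2 : ℝ) • app G C Ψ)
    + wedge ((dot G A A)ᵀ *ᵥ w) ((1 / 2 : ℝ) • (app G DC Ψ + app G C DΨ)))
    + (wedge (DCᵀ *ᵥ w) ((-(1 / 2) : ℝ) • app G (dot G A A) Ψ)
    + wedge (Cᵀ *ᵥ w) ((-(1 / 2) : ℝ) •
        (app G (dot G DA A + dot G A DA) Ψ + app G (dot G A A) DΨ)))
    + (wedge ((-(dot G DA A + dot G A DA))ᵀ *ᵥ w) ((1 / 2 : ℝ) • app G A Φ)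
    + wedge ((G - dot G A A)ᵀ *ᵥ w) ((1 / 2 : ℝ) • (app G DA Φ + app G A DΦ)))

theorem twist_eq_sum (G A C : Tensor2) (Φ Ψ w : Fin 4 → ℝ) :
    twist G A C Φ Ψ w = ∑ a, w a • twist G A C Φ Ψ (Pi.single a 1) := by
  simp only [twist, smul_add, Finset.sum_add_distrib, ← wedge_mulVec_eq_sum]

theorem mulVec_transpose_pull (B A : Tensor2) (w : Fin 4 → ℝ) :
    Bᵀ *ᵥ (Aᵀ *ᵥ (B *ᵥ w)) = (pull B A)ᵀ *ᵥ w := by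
  rw [← pull_transpose, pull, Matrix.mulVec_mulVec, Matrix.mulVec_mulVec, Matrix.mul_assoc]

theorem pull_twist {B : Tensor2} (hB : IsUnit B.det) (G A C : Tensor2) (Φ Ψ w : Fin 4 → ℝ) :
    pull B (twist G A C Φ Ψ (B *ᵥ w))
      = twist (pull B G) (pull B A) (pull B C) (Bᵀ *ᵥ Φ) (Bᵀ *ᵥ Ψ) w := by
  simp only [twist, pull_add, pull_wedge, mulVec_transpose_pull, Matrix.mulVec_smul, mulVec_app hB,
    pull_dot hB, pull_sub]

theorem pull_covTwist {B : Tensor2} (hB : IsUnit B.det) (G A C DA DC : Tensor2)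
    (Φ Ψ DΦ DΨ w : Fin 4 → ℝ) :
    pull B (covTwist G A C DA DC Φ Ψ DΦ DΨ (B *ᵥ w))
      = covTwist (pull B G) (pull B A) (pull B C) (pull B DA) (pull B DC) (Bᵀ *ᵥ Φ) (Bᵀ *ᵥ Ψ)
        (Bᵀ *ᵥ DΦ) (Bᵀ *ᵥ DΨ) w := by
  simp only [covTwist, pull_add, pull_wedge, mulVec_transpose_pull, Matrix.mulVec_smul,
    Matrix.mulVec_add, mulVec_app hB, pull_dot hB, pull_sub, pull_neg]

/-- This identifies the invariant expression with the solved frame components. Since `twist`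
contains no frame, the resulting formula for `∇U` can be differentiated. -/
theorem twist_frame (Φ Ψ : Fin 4 → ℝ) (a : Fin 4) :
    twist minkowski frameU frameW Φ Ψ (Pi.single a 1) = frameDU Φ Ψ a := by
  rw [twist, minkowski_sub_dot_frameU, dot_frameU]
  ext i j
  simp only [Matrix.add_apply, wedge_apply, Pi.smul_apply, smul_eq_mul, app_minkowski_apply,
    Matrix.mulVec_single_one, Matrix.col_apply, Matrix.transpose_apply, Matrix.diagonal_apply]
  fin_cases a <;> fin_cases i <;> fin_cases j <;>
    simp [frameU, frameW, frameDU, mixedForm] <;> ring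

section Fields

variable {g F : E4 → Tensor2} {p : E4 → Fin 4 → ℝ} {Ω : Set E4} {y : E4}

theorem cov₂_frame_sum (g F : E4 → Tensor2) (B : Tensor2) (c : Fin 4 → ℝ) (y : E4) :
    cov₂ g F (WithLp.toLp 2 (B *ᵥ c)) y = ∑ a, c a • cov₂ g F (frameVec B a) y := by
  rw [cov₂_eq_sum]
  simp only [cov₂_eq_sum g F (frameVec B _), Finset.smul_sum]
  rw [Finset.sum_comm]
  refine Finset.sum_congr rfl fun k _ => ?_
  simp only [smul_smul, ← Finset.sum_smul]
  congr 1
  change ∑ a, B k a * c a = ∑ a, c a * B k a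
  exact Finset.sum_congr rfl fun a _ => mul_comm _ _

/-- The vector `w` has constant components but is not parallel: `∇_x w = Γ_x w`, which accounts for
the last term. -/
theorem IsMetricOn.cov_wedge_term (hg : IsMetricOn g Ω) (hF : SmoothM F Ω) (hp : SmoothV p Ω)
    (hy : y ∈ Ω) (x w : E4) :
    cov₂ g (fun z => wedge ((F z)ᵀ *ᵥ w) (p z)) x y
      = wedge ((cov₂ g F x y)ᵀ *ᵥ w) (p y) + wedge ((F y)ᵀ *ᵥ w) (cov₁ g p x y)
        + wedge ((F y)ᵀ *ᵥ (connMatrix g x y *ᵥ w)) (p y) := by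
  have hFw : SmoothV (fun z => (F z)ᵀ *ᵥ w) Ω := hF.transpose.mulVec (SmoothV.const _)
  simp only [wedge]
  rw [hg.cov_sub (hFw.vecMulVec hp) (hp.vecMulVec hFw) hy, hg.cov_vecMulVec hFw hp hy,
    hg.cov_vecMulVec hp hFw hy, hg.cov_contract hF hy]
  simp only [Matrix.add_vecMulVec, Matrix.vecMulVec_add]
  abel

theorem SmoothM.wedge_term (hF : SmoothM F Ω) (hp : SmoothV p Ω) (w : E4) :
    SmoothM (fun z => wedge ((F z)ᵀ *ᵥ w) (p z)) Ω :=
  have hFw : SmoothV (fun z => (F z)ᵀ *ᵥ w) Ω := hF.transpose.mulVec (SmoothV.const _)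
  (hFw.vecMulVec hp).sub (hp.vecMulVec hFw)

/-- Leibniz on each wedge, with `∇g = 0` and hence `∇h = -∇v`. The final `twist` term collects the
derivative of the non-parallel `w`; it drops out once `x` and `w` are antisymmetrized. -/
theorem IsMetricOn.cov_twist (hg : IsMetricOn g Ω) {A C : E4 → Tensor2} {Φ Ψ : E4 → Fin 4 → ℝ}
    (hA : SmoothM A Ω) (hC : SmoothM C Ω) (hΦ : SmoothV Φ Ω) (hΨ : SmoothV Ψ Ω) (hy : y ∈ Ω)
    (x w : E4) :
    cov₂ g (fun z => twist (g z) (A z) (C z) (Φ z) (Ψ z) w) x y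
      = covTwist (g y) (A y) (C y) (cov₂ g A x y) (cov₂ g C x y) (Φ y) (Ψ y) (cov₁ g Φ x y)
          (cov₁ g Ψ x y) w
        + twist (g y) (A y) (C y) (Φ y) (Ψ y) (connMatrix g x y *ᵥ w) := by
  have hv := hg.smooth_dot hA hA
  have hh := hg.smooth.sub hv
  have p1 := hg.smooth_app hh hΦ
  have p2 := hg.smooth_app hC hΨ
  have p3 := hg.smooth_app hv hΨ
  have p4 := hg.smooth_app hA hΦ
  have t1 := hA.wedge_term (p1.smul (-(1 / 2))) w
  have t2 := hv.wedge_term (p2.smul (1 / 2)) w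
  have t3 := hC.wedge_term (p3.smul (-(1 / 2))) w
  have t4 := hh.wedge_term (p4.smul (1 / 2)) w
  simp only [twist]
  rw [hg.cov_add ((t1.add t2).add t3) t4 hy, hg.cov_add (t1.add t2) t3 hy, hg.cov_add t1 t2 hy,
    hg.cov_wedge_term hA (p1.smul _) hy, hg.cov_wedge_term hv (p2.smul _) hy,
    hg.cov_wedge_term hC (p3.smul _) hy, hg.cov_wedge_term hh (p4.smul _) hy,
    hg.cov_smul _ p1 hy, hg.cov_smul _ p2 hy, hg.cov_smul _ p3 hy, hg.cov_smul _ p4 hy,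
    hg.cov_app hh hΦ hy, hg.cov_app hC hΨ hy, hg.cov_app hv hΨ hy, hg.cov_app hA hΦ hy,
    hg.cov_sub hg.smooth hv hy, hg.cov_metric hy, hg.cov_dot hA hA hy, zero_sub, covTwist]
  abel

end Fields

/-! ### Adapted frames at a point and the equations for `∇U` and `∇*U`. -/

/-- `B` is an adapted orthonormal frame for the metric `G`, the canonical 2-form `A` and its
dual `C`. -/
structure IsAdapted (G A C B : Tensor2) : Prop where
  metric : pull B G = minkowski
  form : pull B A = frameU
  dual : pull B C = frameW

theorem det_minkowski : minkowski.det = -1 := by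
  rw [minkowski, Matrix.det_diagonal]
  simp [Fin.prod_univ_four]

theorem IsAdapted.isUnit_det {G A C B : Tensor2} (h : IsAdapted G A C B) : IsUnit B.det := by
  have := congrArg Matrix.det h.metric
  rw [pull, Matrix.det_mul, det_minkowski] at this
  refine isUnit_iff_ne_zero.2 fun h0 => ?_
  rw [h0, mul_zero] at this
  norm_num at this

theorem frameU_transpose : frameUᵀ = -frameU := by
  ext i j
  fin_cases i <;> fin_cases j <;> simp [frameU]

theorem frameW_transpose : frameWᵀ = -frameW := by
  ext i j
  fin_cases i <;> fin_cases j <;> simp [frameW]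

namespace IsAdapted

variable {G A C B : Tensor2}

theorem form_transpose (h : IsAdapted G A C B) : Aᵀ = -A := by
  apply pull_injective h.isUnit_det
  rw [pull_transpose, pull_neg, h.form, frameU_transpose]

theorem dual_transpose (h : IsAdapted G A C B) : Cᵀ = -C := by
  apply pull_injective h.isUnit_det
  rw [pull_transpose, pull_neg, h.dual, frameW_transpose]

theorem form_cube (h : IsAdapted G A C B) : dot G (dot G A A) A = A := by
  apply pull_injective h.isUnit_det
  rw [pull_dot h.isUnit_det, pull_dot h.isUnit_det, h.metric, h.form, dot_frameU]
  ext i j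
  rw [dot_minkowski_apply]
  fin_cases i <;> fin_cases j <;> simp [frameU]

theorem dual_sq (h : IsAdapted G A C B) : dot G C C = dot G A A - G := by
  apply pull_injective h.isUnit_det
  rw [pull_dot h.isUnit_det, pull_sub, pull_dot h.isUnit_det, h.metric, h.form, h.dual,
    ← neg_sub, minkowski_sub_dot_frameU]
  ext i j
  rw [dot_minkowski_apply]
  fin_cases i <;> fin_cases j <;> simp [frameW]

theorem form_dual (h : IsAdapted G A C B) : dot G A C = 0 := by
  apply pull_injective h.isUnit_det
  rw [pull_dot h.isUnit_det, h.metric, h.form, h.dual, pull_zero]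
  ext i j
  rw [dot_minkowski_apply]
  fin_cases i <;> fin_cases j <;> simp [frameU, frameW]

theorem vProj_sq (h : IsAdapted G A C B) : dot G (dot G A A) (dot G A A) = dot G A A := by
  apply pull_injective h.isUnit_det
  rw [pull_dot h.isUnit_det, pull_dot h.isUnit_det, h.metric, h.form, dot_frameU]
  ext i j
  rw [dot_minkowski_apply]
  fin_cases i <;> fin_cases j <;> simp

theorem hProj_sq (h : IsAdapted G A C B) :
    dot G (G - dot G A A) (G - dot G A A) = G - dot G A A := by
  apply pull_injective h.isUnit_det
  rw [pull_dot h.isUnit_det, pull_sub, pull_dot h.isUnit_det, h.metric, h.form,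
    minkowski_sub_dot_frameU]
  ext i j
  rw [dot_minkowski_apply]
  fin_cases i <;> fin_cases j <;> simp

end IsAdapted

theorem IsMetricOn.isFrameUmbilical {g P : E4 → Tensor2} {Ω : Set E4} {y : E4}
    (hg : IsMetricOn g Ω) (hP : SmoothM P Ω) (hPP : ∀ z ∈ Ω, dot (g z) (P z) (P z) = P z)
    (hy : y ∈ Ω) {B : Tensor2} (hB : IsUnit B.det) (hgB : pull B (g y) = minkowski)
    (hu : IsUmbilicalAt g P y) :
    IsFrameUmbilical (pull B (P y)) fun m => pull B (cov₂ g P (frameVec B m) y) := by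
  intro c a b
  have h := hg.umbilical_pull hP hPP hy hB hu c
    (frameSecondForm (pull B (P y)) (fun m => pull B (cov₂ g P (frameVec B m) y)) c)
  rw [hgB, minkowski_inv] at h
  exact h (fun _ _ => rfl) a b

/-- A smooth 2+2 structure on a set: a metric, a 2-form and its dual with adapted frames. -/
structure IsStructureOn (g : E4 → Tensor2) (η : E4 → Fin 4 → Fin 4 → Fin 4 → Fin 4 → ℝ)
    (u : E4 → Tensor2) (Ω : Set E4) : Prop where
  metric : IsMetricOn g Ω
  smooth_form : SmoothM u Ω
  smooth_dual : SmoothM (starField g η u) Ω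
  frame : ∀ z ∈ Ω, ∃ B, IsAdapted (g z) (u z) (starField g η u z) B

theorem pull_cov₂_frameVec (g F : E4 → Tensor2) (B : Tensor2) (a : Fin 4) (y : E4) :
    pull B (cov₂ g F (frameVec B a) y)
      = ∑ k, B k a • pull B (cov₂ g F (EuclideanSpace.single k 1) y) := by
  rw [cov₂_eq_sum, pull_sum]
  simp only [pull_smul]
  rfl

/-- The codifferential is a metric contraction, so `sum_mul_pull` moves it to the frame; the
covariant derivative is linear in its direction as well as in its two slots. -/
theorem mulVec_codiff₂ (g F : E4 → Tensor2) {B : Tensor2} {y : E4} (hB : IsUnit B.det)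
    (h : pull B (g y) = minkowski) :
    Bᵀ *ᵥ codiff₂ g F y = frameCodiff fun a => pull B (cov₂ g F (frameVec B a) y) := by
  ext c
  have h1 : (Bᵀ *ᵥ codiff₂ g F y) c = -∑ k, ∑ i, (g y)⁻¹ k i *
      (Matrix.of fun k i => ∑ j, B j c * covDeriv₂ g F y k i j : Tensor2) k i := by
    simp only [codiff₂, Matrix.mulVec, dotProduct, Matrix.transpose_apply, mul_neg,
      Finset.sum_neg_distrib, Finset.mul_sum, Matrix.of_apply]
    congr 1
    rw [Finset.sum_comm_cycle]
    rw [Finset.sum_comm_cycle]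
    exact Finset.sum_congr rfl fun k _ => Finset.sum_congr rfl fun i _ =>
      Finset.sum_congr rfl fun j _ => by ring
  rw [h1, pull_inv hB (g y), sum_mul_pull, h, minkowski_inv, frameCodiff]
  congr 1
  refine Finset.sum_congr rfl fun a _ => Finset.sum_congr rfl fun b _ => ?_
  congr 1
  rw [pull_cov₂_frameVec, pull_eq_sum, Matrix.sum_apply]
  refine Finset.sum_congr rfl fun k _ => ?_
  rw [Matrix.smul_apply, pull_eq_sum, smul_eq_mul, Finset.mul_sum]
  refine Finset.sum_congr rfl fun i _ => ?_
  rw [Matrix.of_apply, Finset.mul_sum, Finset.mul_sum]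
  refine Finset.sum_congr rfl fun j _ => ?_
  rw [covDeriv₂_eq]
  ring

theorem pull_covDeriv₁ (g : E4 → Tensor2) (α : E4 → Fin 4 → ℝ) (B : Tensor2) (y : E4)
    (a c : Fin 4) :
    pull B (Matrix.of (covDeriv₁ g α y)) a c = (Bᵀ *ᵥ cov₁ g α (frameVec B a) y) c := by
  rw [pull_eq_sum, cov₁_eq_sum]
  simp only [Matrix.mulVec, dotProduct, Finset.sum_apply, Pi.smul_apply, smul_eq_mul,
    Matrix.transpose_apply, Finset.mul_sum, Matrix.of_apply, covDeriv₁_eq]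
  rw [Finset.sum_comm]
  exact Finset.sum_congr rfl fun i _ => Finset.sum_congr rfl fun j _ => by
    simp only [frameVec]; ring

namespace IsStructureOn

variable {g u : E4 → Tensor2} {η : E4 → Fin 4 → Fin 4 → Fin 4 → Fin 4 → ℝ} {Ω : Set E4} {y : E4}
  {B : Tensor2}

theorem cov_eq_of_eqOn (h : IsStructureOn g η u Ω) {F G : E4 → Tensor2}
    (hFG : ∀ z ∈ Ω, F z = G z) (hy : y ∈ Ω) (x : E4) : cov₂ g F x y = cov₂ g G x y := by
  apply cov₂_congr
  filter_upwards [h.metric.isOpen.mem_nhds hy] with z hz using hFG z hz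

theorem cov_transpose_eq_neg (h : IsStructureOn g η u Ω) {F : E4 → Tensor2}
    (hF : ∀ z ∈ Ω, (F z)ᵀ = -F z) (hy : y ∈ Ω) (x : E4) : (cov₂ g F x y)ᵀ = -cov₂ g F x y := by
  have h1 : dirM (fun z => (F z)ᵀ) x y = dirM (fun z => -F z) x y := by
    apply dirM_congr
    filter_upwards [h.metric.isOpen.mem_nhds hy] with z hz using hF z hz
  have h2 : dirM (fun z => -F z) x y = -dirM F x y := by
    ext i j
    simp [dirM]
  rw [dirM_transpose, h2] at h1
  simp only [cov₂, Matrix.transpose_sub, Matrix.transpose_mul, Matrix.transpose_transpose, h1,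
    hF y hy]
  noncomm_ring

/-- The structure equations of an umbilical structure in an adapted frame. -/
theorem frame_cov (h : IsStructureOn g η u Ω) (hy : y ∈ Ω)
    (hB : IsAdapted (g y) (u y) (starField g η u y) B)
    (hv : IsUmbilicalAt g (vProj g u) y) (hh : IsUmbilicalAt g (hProj g u) y) :
    (fun a => pull B (cov₂ g u (frameVec B a) y))
        = frameDU (Bᵀ *ᵥ expansion g η u y) (Bᵀ *ᵥ rotation g η u y) ∧
      (fun a => pull B (cov₂ g (starField g η u) (frameVec B a) y))
        = frameDW (Bᵀ *ᵥ expansion g η u y) (Bᵀ *ᵥ rotation g η u y) := by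
  have hm := h.metric
  have hU := h.smooth_form
  have hW := h.smooth_dual
  have hd := hB.isUnit_det
  have hvs : SmoothM (vProj g u) Ω := hm.smooth_dot hU hU
  have hhs : SmoothM (hProj g u) Ω := hm.smooth.sub hvs
  have hcv : ∀ x, cov₂ g (vProj g u) x y
      = dot (g y) (cov₂ g u x y) (u y) + dot (g y) (u y) (cov₂ g u x y) :=
    fun x => hm.cov_dot hU hU hy
  have hch : ∀ x, cov₂ g (hProj g u) x y
      = -(dot (g y) (cov₂ g u x y) (u y) + dot (g y) (u y) (cov₂ g u x y)) := by
    intro x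
    rw [← hcv]
    refine (hm.cov_sub hm.smooth hvs hy).trans ?_
    rw [hm.cov_metric hy, zero_sub]
  -- The next three facts are the covariant derivatives of `U·U·U = U`, `*U·*U = v - g` and `U·*U =
  -- 0`, which hold at every point of the domain.
  have e1 : ∀ x, cov₂ g u x y = dot (g y) (dot (g y) (cov₂ g u x y) (u y)
      + dot (g y) (u y) (cov₂ g u x y)) (u y) + dot (g y) (dot (g y) (u y) (u y)) (cov₂ g u x y) := by
    intro x
    rw [← hcv x]
    refine Eq.trans ?_ (hm.cov_dot hvs hU hy)
    refine h.cov_eq_of_eqOn (fun z hz => ?_) hy x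
    obtain ⟨C, hC⟩ := h.frame z hz
    exact hC.form_cube.symm
  have e2 : ∀ x, dot (g y) (cov₂ g (starField g η u) x y) (starField g η u y)
      + dot (g y) (starField g η u y) (cov₂ g (starField g η u) x y)
      = dot (g y) (cov₂ g u x y) (u y) + dot (g y) (u y) (cov₂ g u x y) := by
    intro x
    rw [← hcv x, ← hm.cov_dot hW hW hy, ← sub_zero (cov₂ g (vProj g u) x y),
      ← hm.cov_metric (x := x) hy, ← hm.cov_sub hvs hm.smooth hy]
    refine h.cov_eq_of_eqOn (fun z hz => ?_) hy x
    obtain ⟨C, hC⟩ := h.frame z hz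
    exact hC.dual_sq
  have e3 : ∀ x, dot (g y) (cov₂ g u x y) (starField g η u y)
      + dot (g y) (u y) (cov₂ g (starField g η u) x y) = 0 := by
    intro x
    rw [← hm.cov_dot hU hW hy, h.cov_eq_of_eqOn (G := fun _ => 0) (fun z hz => ?_) hy x]
    · simp [cov₂, dirM_const]
    · obtain ⟨C, hC⟩ := h.frame z hz
      exact hC.form_dual
  have e4 := fun x => h.cov_transpose_eq_neg (fun z hz => (h.frame z hz).choose_spec.form_transpose)
    hy x
  have e5 := fun x => h.cov_transpose_eq_neg (fun z hz => (h.frame z hz).choose_spec.dual_transpose)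
    hy x
  have key := fun a => mixed_of_relations
    (X := pull B (cov₂ g u (frameVec B a) y))
    (Y := pull B (cov₂ g (starField g η u) (frameVec B a) y))
    (by rw [← pull_transpose, e4, pull_neg]) (by rw [← pull_transpose, e5, pull_neg])
    (by
      have := congrArg (pull B) (e1 (frameVec B a))
      simpa only [pull_add, pull_dot hd, hB.metric, hB.form] using this)
    (by
      have := congrArg (pull B) (e2 (frameVec B a))
      simpa only [pull_add, pull_dot hd, hB.metric, hB.form, hB.dual] using this)
    (by
      have := congrArg (pull B) (e3 (frameVec B a))
      simpa only [pull_add, pull_dot hd, hB.metric, hB.form, hB.dual, pull_zero] using this)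
  refine frame_structure_equations (funext fun a => (key a).1) (funext fun a => (key a).2)
    ?_ ?_ ?_ ?_
  · have := hm.isFrameUmbilical hvs (fun z hz => (h.frame z hz).choose_spec.vProj_sq) hy hd
      hB.metric hv
    simpa only [hcv, vProj, pull_add, pull_dot hd, hB.metric, hB.form] using this
  · have := hm.isFrameUmbilical hhs (fun z hz => (h.frame z hz).choose_spec.hProj_sq) hy hd
      hB.metric hh
    simpa only [hch, vProj, hProj, pull_add, pull_sub, pull_neg, pull_dot hd, hB.metric, hB.form]
      using this
  · rw [expansion, Matrix.mulVec_sub, mulVec_app hd, mulVec_app hd, mulVec_codiff₂ _ _ hd hB.metric,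
      mulVec_codiff₂ _ _ hd hB.metric, hB.metric, hB.form, hB.dual]
  · rw [rotation, Matrix.mulVec_add, mulVec_app hd, mulVec_app hd, mulVec_codiff₂ _ _ hd hB.metric,
      mulVec_codiff₂ _ _ hd hB.metric, hB.metric, hB.form, hB.dual]

/-- The covariant derivative of the canonical 2-form of an umbilical structure. -/
theorem cov_form_eq_twist (h : IsStructureOn g η u Ω) (hy : y ∈ Ω)
    (hv : IsUmbilicalAt g (vProj g u) y) (hh : IsUmbilicalAt g (hProj g u) y) (w : E4) :
    cov₂ g u w y
      = twist (g y) (u y) (starField g η u y) (expansion g η u y) (rotation g η u y) w := by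
  obtain ⟨B, hB⟩ := h.frame y hy
  have hd := hB.isUnit_det
  -- Both sides are linear in `w`, so expanding `w` in the adapted frame reduces the identity to the
  -- frame components.
  obtain ⟨c, hc⟩ : ∃ c, w = WithLp.toLp 2 (B *ᵥ c) := ⟨B⁻¹ *ᵥ w, by
    rw [Matrix.mulVec_mulVec, Matrix.mul_nonsing_inv _ hd, Matrix.one_mulVec]⟩
  apply pull_injective hd
  rw [hc, cov₂_frame_sum, pull_sum, pull_twist hd, hB.metric, hB.form, hB.dual, twist_eq_sum]
  refine Finset.sum_congr rfl fun a _ => ?_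
  rw [pull_smul, twist_frame, ← (h.frame_cov hy hB hv hh).1]

end IsStructureOn

/-! ### Algebra at a point: from the Ricci identity for `U` to the Ricci tensor. -/

/-- The symmetries of a curvature tensor. -/
structure IsCurvatureLike (t : Fin 4 → Fin 4 → Fin 4 → Fin 4 → ℝ) : Prop where
  swap_left : ∀ a b c d, t b a c d = -t a b c d
  swap_right : ∀ a b c d, t a b d c = -t a b c d
  bianchi : ∀ a b c d, t a b c d + t a c d b + t a d b c = 0

/-- The classical argument: combine the four cyclic identities obtained by rotating the indices,
then cancel with the two antisymmetries. -/
theorem IsCurvatureLike.pair_symm {t : Fin 4 → Fin 4 → Fin 4 → Fin 4 → ℝ}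
    (h : IsCurvatureLike t) (a b c d : Fin 4) : t c d a b = t a b c d := by
  have h1 := h.bianchi a b c d
  have h2 := h.bianchi b c d a
  have h3 := h.bianchi c d a b
  have h4 := h.bianchi d a b c
  have e1 := h.swap_left a b c d
  have e2 := h.swap_right a b c d
  have e3 := h.swap_left c d a b
  have e4 := h.swap_right c d a b
  have f1 := h.swap_left a c b d
  have f2 := h.swap_right a c b d
  have f3 := h.swap_right c a b d
  have f4 := h.swap_left b d a c
  have f5 := h.swap_right b d a c
  have f6 := h.swap_right d b a c
  have g1 := h.swap_left a d b c
  have g2 := h.swap_right a d b c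
  have g3 := h.swap_right d a b c
  have g4 := h.swap_left b c a d
  have g5 := h.swap_right b c a d
  have g6 := h.swap_right c b a d
  have e5 := h.swap_right b a c d
  have e6 := h.swap_right d c a b
  linarith

theorem contract_minkowski_diagonal (s x y : Fin 4 → ℝ) :
    contract minkowski (Matrix.diagonal s) x y
      = s 0 * x 0 * y 0 + s 1 * x 1 * y 1 + s 2 * x 2 * y 2 + s 3 * x 3 * y 3 := by
  have h : ∀ x : Fin 4 → ℝ, minkowski *ᵥ x = fun i => ![-1, 1, 1, 1] i * x i := fun x => by
    ext i
    rw [minkowski, Matrix.mulVec_diagonal]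
  rw [contract, minkowski_inv, h, h, dotProduct, Fin.sum_univ_four]
  simp [Matrix.mulVec_diagonal]
  ring

theorem sum_diagonal_mul (s : Fin 4 → ℝ) (D : Tensor2) :
    ∑ i, ∑ j, Matrix.diagonal s i j * D i j
      = s 0 * D 0 0 + s 1 * D 1 1 + s 2 * D 2 2 + s 3 * D 3 3 := by
  simp [Matrix.diagonal_apply, Fin.sum_univ_four]

/-- The expression of the Ricci tensor of an umbilical structure, in an orthonormal frame. -/
def frameRicci (Φ Ψ : Fin 4 → ℝ) (DΦ DΨ : Tensor2) (X Y : ℝ) : Tensor2 :=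
  (1 / 4 : ℝ) • (((1 / 2) * (4 * (X + Y) + 3 * contract minkowski minkowski Φ Φ
      - 3 * contract minkowski minkowski Ψ Ψ
      - 2 * (-∑ i, ∑ j, minkowski i j * DΦ i j))) • minkowski
    + ((1 / 2) * (4 * (X - Y) + contract minkowski (Matrix.diagonal ![-1, 1, -1, -1]) Φ Φ
      - contract minkowski (Matrix.diagonal ![-1, 1, -1, -1]) Ψ Ψ
      + 2 * (-∑ i, ∑ j, Matrix.diagonal ![-1, 1, -1, -1] i j * DΦ i j)))
      • Matrix.diagonal ![-1, 1, -1, -1])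
  + (1 / 2 : ℝ) • ((DΦ + DΦᵀ - tensor Φ Φ + tensor Ψ Ψ)
    - dot minkowski (dot minkowski frameU (DΨ + DΨᵀ - (tensor Φ Ψ + tensor Ψ Φ))) frameW
    - dot minkowski (dot minkowski frameW (DΨ + DΨᵀ - (tensor Φ Ψ + tensor Ψ Φ))) frameU)

/-- The symmetric counterpart of `mixedForm`. -/
def mixedSymm (p q r s : ℝ) : Tensor2 :=
  !![0, 0, p, q; 0, 0, r, s; p, r, 0, 0; q, s, 0, 0]

theorem dot_mixedForm_frameU (p q r s : ℝ) :
    dot minkowski (mixedForm p q r s) frameU + dot minkowski frameU (mixedForm p q r s)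
      = mixedSymm r s p q := by
  ext i j
  rw [Matrix.add_apply, dot_minkowski_apply, dot_minkowski_apply]
  fin_cases i <;> fin_cases j <;> simp [mixedForm, mixedSymm, frameU]

theorem app_mixedForm (p q r s : ℝ) (x : Fin 4 → ℝ) : app minkowski (mixedForm p q r s) x
    = ![p * x 2 + q * x 3, r * x 2 + s * x 3, p * x 0 - r * x 1, q * x 0 - s * x 1] := by
  ext i
  rw [app_minkowski_apply]
  fin_cases i <;> simp [mixedForm] <;> ring

theorem app_mixedSymm (p q r s : ℝ) (x : Fin 4 → ℝ) : app minkowski (mixedSymm p q r s) x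
    = ![p * x 2 + q * x 3, r * x 2 + s * x 3, -p * x 0 + r * x 1, -q * x 0 + s * x 1] := by
  ext i
  rw [app_minkowski_apply]
  fin_cases i <;> simp [mixedSymm]

theorem app_neg (G A : Tensor2) (x : Fin 4 → ℝ) : app G (-A) x = -app G A x := by
  rw [app, app, Matrix.neg_mulVec]

theorem app_frameU (x : Fin 4 → ℝ) : app minkowski frameU x = ![x 1, x 0, 0, 0] := by
  ext i
  rw [app_minkowski_apply]
  fin_cases i <;> simp [frameU]

theorem app_frameW (x : Fin 4 → ℝ) : app minkowski frameW x = ![0, 0, x 3, -x 2] := by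
  ext i
  rw [app_minkowski_apply]
  fin_cases i <;> simp [frameW]

theorem app_diagonal_time (x : Fin 4 → ℝ) :
    app minkowski (Matrix.diagonal ![-1, 1, 0, 0]) x = ![x 0, x 1, 0, 0] := by
  ext i
  rw [app_minkowski_apply]
  fin_cases i <;> simp

theorem app_diagonal_space (x : Fin 4 → ℝ) :
    app minkowski (Matrix.diagonal ![0, 0, 1, 1]) x = ![0, 0, x 2, x 3] := by
  ext i
  rw [app_minkowski_apply]
  fin_cases i <;> simp

/-- The components of `covTwist` in an adapted frame which mix the two planes. -/
theorem covTwist_frame (p q r s : ℝ) (Φ Ψ DΦ DΨ : Fin 4 → ℝ) (k : Fin 4) :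
    covTwist minkowski frameU frameW (mixedForm p q r s) (mixedForm s (-r) q (-p)) Φ Ψ DΦ DΨ
      (Pi.single k 1)
    = (1 / 2 : ℝ) • (wedge (mixedForm p q r s k) ![0, 0, -Φ 2, -Φ 3]
      + wedge (frameU k) ![r * Φ 2 + s * Φ 3, p * Φ 2 + q * Φ 3,
          -r * Φ 0 + p * Φ 1 - DΦ 2, -s * Φ 0 + q * Φ 1 - DΦ 3]
      + wedge (mixedSymm r s p q k) ![0, 0, Ψ 3, -Ψ 2]
      + wedge (Matrix.diagonal ![-1, 1, 0, 0] k) ![s * Ψ 2 - r * Ψ 3, q * Ψ 2 - p * Ψ 3,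
          s * Ψ 0 - q * Ψ 1 + DΨ 3, -r * Ψ 0 + p * Ψ 1 - DΨ 2]
      - wedge (mixedForm s (-r) q (-p) k) ![Ψ 0, Ψ 1, 0, 0]
      - wedge (frameW k) ![r * Ψ 2 + s * Ψ 3 + DΨ 0, p * Ψ 2 + q * Ψ 3 + DΨ 1,
          -r * Ψ 0 + p * Ψ 1, -s * Ψ 0 + q * Ψ 1]
      - wedge (mixedSymm r s p q k) ![Φ 1, Φ 0, 0, 0]
      + wedge (Matrix.diagonal ![0, 0, 1, 1] k) ![p * Φ 2 + q * Φ 3 + DΦ 1,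
          r * Φ 2 + s * Φ 3 + DΦ 0, p * Φ 0 - r * Φ 1, q * Φ 0 - s * Φ 1]) := by
  rw [covTwist, dot_mixedForm_frameU, minkowski_sub_dot_frameU, dot_frameU]
  simp only [app_neg, app_mixedForm, app_mixedSymm, app_frameU, app_frameW, app_diagonal_time,
    app_diagonal_space]
  have hk : ∀ A : Tensor2, Aᵀ *ᵥ Pi.single k 1 = A k := fun A => by
    rw [Matrix.mulVec_single_one]
    rfl
  simp only [hk]
  -- Keeping the `k`-th rows opaque makes the identity polynomial in their entries, with no case
  -- split on `k`.
  generalize hA : mixedForm p q r s k = A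
  generalize hC : mixedSymm r s p q k = C
  generalize hD : mixedForm s (-r) q (-p) k = D
  generalize frameU k = E
  generalize frameW k = F
  generalize (Matrix.diagonal ![-1, 1, 0, 0] : Tensor2) k = G
  generalize (Matrix.diagonal ![0, 0, 1, 1] : Tensor2) k = H
  have hC' : (-mixedSymm r s p q) k = -C := by rw [← hC]; rfl
  rw [hC']
  ext i j
  simp only [Matrix.add_apply, Matrix.sub_apply, Matrix.smul_apply, wedge_apply, Pi.smul_apply,
    Pi.add_apply, Pi.neg_apply, smul_eq_mul]
  fin_cases i <;> fin_cases j <;> simp <;> ring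

/-- `U` lives on `V` and `*U` on `H`, so `N` is seen only through its components mixing the two
planes, and it contributes only to the mixed block. -/
theorem frameU_dot_dot_frameW (N : Tensor2) (hN : Nᵀ = N) :
    dot minkowski (dot minkowski frameU N) frameW + dot minkowski (dot minkowski frameW N) frameU
      = mixedSymm (-N 1 3) (N 1 2) (-N 0 3) (N 0 2) := by
  have h := fun i j => congrFun (congrFun hN i) j
  simp only [Matrix.transpose_apply] at h
  ext i j
  simp only [Matrix.add_apply, dot_minkowski_apply]
  fin_cases i <;> fin_cases j <;> simp [frameU, frameW, mixedSymm, h 2 1, h 2 0, h 3 0, h 3 1]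

theorem frameRicci_apply (Φ Ψ : Fin 4 → ℝ) (DΦ DΨ : Tensor2) (X Y : ℝ) (b d : Fin 4) :
    frameRicci Φ Ψ DΦ DΨ X Y b d = (1 / 8) * (4 * (X + Y)
        + 3 * (-Φ 0 * Φ 0 + Φ 1 * Φ 1 + Φ 2 * Φ 2 + Φ 3 * Φ 3)
        - 3 * (-Ψ 0 * Ψ 0 + Ψ 1 * Ψ 1 + Ψ 2 * Ψ 2 + Ψ 3 * Ψ 3)
        + 2 * (-DΦ 0 0 + DΦ 1 1 + DΦ 2 2 + DΦ 3 3)) * minkowski b d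
      + (1 / 8) * (4 * (X - Y) + (-Φ 0 * Φ 0 + Φ 1 * Φ 1 - Φ 2 * Φ 2 - Φ 3 * Φ 3)
        - (-Ψ 0 * Ψ 0 + Ψ 1 * Ψ 1 - Ψ 2 * Ψ 2 - Ψ 3 * Ψ 3)
        - 2 * (-DΦ 0 0 + DΦ 1 1 - DΦ 2 2 - DΦ 3 3)) * Matrix.diagonal ![-1, 1, -1, -1] b d
      + (1 / 2) * (DΦ b d + DΦ d b - Φ b * Φ d + Ψ b * Ψ d
        - mixedSymm (-(DΨ 1 3 + DΨ 3 1 - (Φ 1 * Ψ 3 + Ψ 1 * Φ 3)))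
          (DΨ 1 2 + DΨ 2 1 - (Φ 1 * Ψ 2 + Ψ 1 * Φ 2))
          (-(DΨ 0 3 + DΨ 3 0 - (Φ 0 * Ψ 3 + Ψ 0 * Φ 3)))
          (DΨ 0 2 + DΨ 2 0 - (Φ 0 * Ψ 2 + Ψ 0 * Φ 2)) b d) := by
  have hN : (DΨ + DΨᵀ - (tensor Φ Ψ + tensor Ψ Φ))ᵀ = DΨ + DΨᵀ - (tensor Φ Ψ + tensor Ψ Φ) := by
    simp only [Matrix.transpose_sub, Matrix.transpose_add, Matrix.transpose_transpose, tensor,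
      Matrix.transpose_vecMulVec]
    rw [add_comm DΨᵀ, add_comm (Matrix.vecMulVec Ψ Φ)]
  rw [frameRicci, sub_sub _ (dot _ _ _), frameU_dot_dot_frameW _ hN]
  simp only [Matrix.add_apply, Matrix.sub_apply, Matrix.smul_apply, smul_eq_mul, tensor,
    Matrix.vecMulVec_apply, Matrix.transpose_apply, contract_minkowski_diagonal, sum_diagonal_mul]
  generalize mixedSymm _ _ _ _ b d = Z
  have hm : ∀ x, contract minkowski minkowski x x
      = -x 0 * x 0 + x 1 * x 1 + x 2 * x 2 + x 3 * x 3 := by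
    intro x
    refine (contract_minkowski_diagonal _ x x).trans ?_
    simp
  rw [hm, hm]
  simp only [minkowski, sum_diagonal_mul]
  generalize (Matrix.diagonal ![-1, 1, 1, 1] : Tensor2) b d = m
  generalize (Matrix.diagonal ![-1, 1, -1, -1] : Tensor2) b d = n
  simp
  ring

theorem frameRicci_symm (Φ Ψ : Fin 4 → ℝ) (DΦ DΨ : Tensor2) (X Y : ℝ) (b d : Fin 4) :
    frameRicci Φ Ψ DΦ DΨ X Y b d = frameRicci Φ Ψ DΦ DΨ X Y d b := by
  have h : ∀ s : Fin 4 → ℝ, (Matrix.diagonal s : Tensor2) b d = Matrix.diagonal s d b := fun s =>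
    congrFun (congrFun (Matrix.diagonal_transpose s) d) b
  have hm : ∀ p q r s, mixedSymm p q r s b d = mixedSymm p q r s d b := by
    intro p q r s
    fin_cases b <;> fin_cases d <;> rfl
  rw [frameRicci_apply, frameRicci_apply, minkowski, h, h, hm]
  ring

set_option maxHeartbeats 1000000 in
/-- The Ricci identity for the canonical 2-form determines the Ricci tensor, up to the sectional
curvatures of the two planes. -/
theorem ricci_eq_frameRicci {Φ Ψ : Fin 4 → ℝ} {DΦ DΨ : Tensor2}
    {t : Fin 4 → Fin 4 → Fin 4 → Fin 4 → ℝ} (ht : IsCurvatureLike t)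
    (hR : ∀ l k, covTwist minkowski frameU frameW (frameDU Φ Ψ l) (frameDW Φ Ψ l) Φ Ψ (DΦ l) (DΨ l)
        (Pi.single k 1)
      - covTwist minkowski frameU frameW (frameDU Φ Ψ k) (frameDW Φ Ψ k) Φ Ψ (DΦ k) (DΨ k)
        (Pi.single l 1)
      = dot minkowski (Matrix.of fun a b => t a b l k) frameU
        - dot minkowski frameU (Matrix.of fun a b => t a b l k)) (b d : Fin 4) :
    ∑ c, ∑ a, minkowski c a * t a b c d
      = frameRicci Φ Ψ DΦ DΨ (-t 0 1 0 1) (t 2 3 2 3) b d := by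
  have frameDW' : ∀ l, frameDW Φ Ψ l = mixedForm (![-Φ 3 / 2, -Ψ 2 / 2, Ψ 1 / 2, -Φ 0 / 2] l)
      (-![-Φ 2 / 2, Ψ 3 / 2, -Φ 0 / 2, -Ψ 1 / 2] l) (![Ψ 2 / 2, Φ 3 / 2, Ψ 0 / 2, -Φ 1 / 2] l)
      (-![-Ψ 3 / 2, Φ 2 / 2, -Φ 1 / 2, -Ψ 0 / 2] l) := by
    intro l
    fin_cases l <;> simp [frameDW, neg_div]
  have key := fun l k i j => congrFun (congrFun (hR l k) i) j
  clear hR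
  simp only [frameDU, frameDW'] at key
  simp only [covTwist_frame, Matrix.sub_apply, Matrix.smul_apply, Matrix.add_apply, wedge_apply,
    smul_eq_mul, dot_minkowski_apply, Matrix.of_apply, Matrix.diagonal_apply] at key
  have hL : ∀ b d, ∑ c, ∑ a, minkowski c a * t a b c d
      = -t 0 b 0 d + t 1 b 1 d + t 2 b 2 d + t 3 b 3 d := by
    intro b d
    simp [minkowski_apply, Fin.sum_univ_four]
  -- For `i` in `V` and `j` in `H`, multiplication by `U` exchanges 0 and 1, so the `(i, j)` entry
  -- of the commutator is, up to sign, the component with first index `1 - i` and second index `j`.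
  -- Each name records the component thus obtained.
  have r0202 := key 0 2 1 2
  have r0303 := key 0 3 1 3
  have r1212 := key 1 2 0 2
  have r1313 := key 1 3 0 3
  have r0212 := key 1 2 1 2
  have r1202 := key 0 2 0 2
  have r0313 := key 1 3 1 3
  have r1303 := key 0 3 0 3
  have r1201 := key 0 1 0 2
  have r0323 := key 2 3 1 3
  have r1301 := key 0 1 0 3
  have r0223 := key 2 3 1 2
  have r0201 := key 0 1 1 2
  have r1323 := key 2 3 0 3
  have r0301 := key 0 1 1 3
  have r1223 := key 2 3 0 2
  have r0203 := key 0 3 1 2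
  have r0302 := key 0 2 1 3
  have r1213 := key 1 3 0 2
  have r1312 := key 1 2 0 3
  clear key
  simp [frameU, frameW, mixedForm, mixedSymm] at r0202 r0303 r1212 r1313 r0212 r1202 r0313
  simp [frameU, frameW, mixedForm, mixedSymm] at r1303 r1201 r0323 r1301 r0223 r0201 r1323
  simp [frameU, frameW, mixedForm, mixedSymm] at r0301 r1223 r0203 r0302 r1213 r1312
  have hl : ∀ a c d, t a a c d = 0 := fun a c d => by linarith only [ht.swap_left a a c d]
  have hr : ∀ a b c, t a b c c = 0 := fun a b c => by linarith only [ht.swap_right a b c c]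
  have hs : ∀ a b c d, t b a d c = t a b c d := fun a b c d => by
    rw [ht.swap_left, ht.swap_right, neg_neg]
  -- Every term of the trace is a component just found, possibly after reordering by the curvature
  -- symmetries, or else one of `t 0 1 0 1` and `t 2 3 2 3`. The component `t 0 1 2 3` never enters.
  have e00 : ∑ c, ∑ a, minkowski c a * t a 0 c 0
      = frameRicci Φ Ψ DΦ DΨ (-t 0 1 0 1) (t 2 3 2 3) 0 0 := by
    rw [hL]
    simp [frameRicci_apply, minkowski_apply, mixedSymm, hl]
    linarith only [hs 0 1 0 1, hs 0 2 0 2, hs 0 3 0 3, r0202, r0303]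
  have e11 : ∑ c, ∑ a, minkowski c a * t a 1 c 1
      = frameRicci Φ Ψ DΦ DΨ (-t 0 1 0 1) (t 2 3 2 3) 1 1 := by
    rw [hL]
    simp [frameRicci_apply, minkowski_apply, mixedSymm, hl]
    linarith only [hs 1 2 1 2, hs 1 3 1 3, r1212, r1313]
  have e22 : ∑ c, ∑ a, minkowski c a * t a 2 c 2
      = frameRicci Φ Ψ DΦ DΨ (-t 0 1 0 1) (t 2 3 2 3) 2 2 := by
    rw [hL]
    simp [frameRicci_apply, minkowski_apply, mixedSymm, hl]
    linarith only [hs 2 3 2 3, r0202, r1212]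
  have e33 : ∑ c, ∑ a, minkowski c a * t a 3 c 3
      = frameRicci Φ Ψ DΦ DΨ (-t 0 1 0 1) (t 2 3 2 3) 3 3 := by
    rw [hL]
    simp [frameRicci_apply, minkowski_apply, mixedSymm, hl]
    linarith only [r0303, r1313]
  have e01 : ∑ c, ∑ a, minkowski c a * t a 0 c 1
      = frameRicci Φ Ψ DΦ DΨ (-t 0 1 0 1) (t 2 3 2 3) 0 1 := by
    rw [hL]
    simp [frameRicci_apply, minkowski_apply, mixedSymm, hl, hr]
    linarith only [hs 0 2 1 2, hs 0 3 1 3, ht.pair_symm 0 2 1 2, ht.pair_symm 0 3 1 3, r0212, r0313,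
      r1202, r1303]
  have e23 : ∑ c, ∑ a, minkowski c a * t a 2 c 3
      = frameRicci Φ Ψ DΦ DΨ (-t 0 1 0 1) (t 2 3 2 3) 2 3 := by
    rw [hL]
    simp [frameRicci_apply, minkowski_apply, mixedSymm, hl, hr]
    linarith only [ht.pair_symm 0 2 0 3, ht.pair_symm 1 2 1 3, r0203, r0302, r1213, r1312]
  have e02 : ∑ c, ∑ a, minkowski c a * t a 0 c 2
      = frameRicci Φ Ψ DΦ DΨ (-t 0 1 0 1) (t 2 3 2 3) 0 2 := by
    rw [hL]
    simp [frameRicci_apply, minkowski_apply, mixedSymm, hl, hr]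
    linarith only [ht.swap_left 0 1 1 2, ht.pair_symm 0 1 1 2, hs 0 3 2 3, r1201, r0323]
  have e03 : ∑ c, ∑ a, minkowski c a * t a 0 c 3
      = frameRicci Φ Ψ DΦ DΨ (-t 0 1 0 1) (t 2 3 2 3) 0 3 := by
    rw [hL]
    simp [frameRicci_apply, minkowski_apply, mixedSymm, hl, hr]
    linarith only [ht.swap_left 0 1 1 3, ht.pair_symm 0 1 1 3, ht.swap_left 0 2 2 3, r1301, r0223]
  have e12 : ∑ c, ∑ a, minkowski c a * t a 1 c 2
      = frameRicci Φ Ψ DΦ DΨ (-t 0 1 0 1) (t 2 3 2 3) 1 2 := by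
    rw [hL]
    simp [frameRicci_apply, minkowski_apply, mixedSymm, hl, hr]
    linarith only [ht.pair_symm 0 1 0 2, hs 1 3 2 3, r0201, r1323]
  have e13 : ∑ c, ∑ a, minkowski c a * t a 1 c 3
      = frameRicci Φ Ψ DΦ DΨ (-t 0 1 0 1) (t 2 3 2 3) 1 3 := by
    rw [hL]
    simp [frameRicci_apply, minkowski_apply, mixedSymm, hl, hr]
    linarith only [ht.pair_symm 0 1 0 3, ht.swap_left 1 2 2 3, r0301, r1223]
  have hsymm : ∀ b d, ∑ c, ∑ a, minkowski c a * t a b c d = ∑ c, ∑ a, minkowski c a * t a d c b := by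
    intro b d
    rw [hL, hL, ht.pair_symm 0 d 0 b, ht.pair_symm 1 d 1 b, ht.pair_symm 2 d 2 b,
      ht.pair_symm 3 d 3 b]
  fin_cases b <;> fin_cases d
  · exact e00
  · exact e01
  · exact e02
  · exact e03
  · exact (hsymm 1 0).trans (e01.trans (frameRicci_symm _ _ _ _ _ _ _ _))
  · exact e11
  · exact e12
  · exact e13
  · exact (hsymm 2 0).trans (e02.trans (frameRicci_symm _ _ _ _ _ _ _ _))
  · exact (hsymm 2 1).trans (e12.trans (frameRicci_symm _ _ _ _ _ _ _ _))
  · exact e22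
  · exact e23
  · exact (hsymm 3 0).trans (e03.trans (frameRicci_symm _ _ _ _ _ _ _ _))
  · exact (hsymm 3 1).trans (e13.trans (frameRicci_symm _ _ _ _ _ _ _ _))
  · exact (hsymm 3 2).trans (e23.trans (frameRicci_symm _ _ _ _ _ _ _ _))
  · exact e33

/-! ### The curvature scalars `X` and `Y` as frame components. -/

section Curvature

variable {g : E4 → Tensor2} {Ω : Set E4} {y : E4}

theorem isCurvatureLike_frame (hg : IsMetricOn g Ω) (hy : y ∈ Ω) (B : Tensor2) :
    IsCurvatureLike (act Bᵀ (riemann g y)) where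
  swap_left a b c d := by
    have h : ∀ x w, (g y * curvMatrix g x w y)ᵀ = -(g y * curvMatrix g x w y) := by
      intro x w
      rw [Matrix.transpose_mul, hg.symm y hy]
      exact eq_neg_of_add_eq_zero_left (hg.metric_curvMatrix_antisymm hy)
    rw [act_transpose_riemann hg hy, act_transpose_riemann hg hy, ← Matrix.transpose_apply (pull _ _),
      ← pull_transpose, h, pull_neg, Matrix.neg_apply]
  swap_right a b c d := by
    rw [act_transpose_riemann hg hy, act_transpose_riemann hg hy, IsMetricOn.curvMatrix_swap,
      Matrix.mul_neg, pull_neg, Matrix.neg_apply]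
  bianchi a b c d := by
    simp only [act_transpose_riemann hg hy, pull_apply, ← Matrix.mulVec_mulVec]
    rw [← dotProduct_add, ← dotProduct_add, ← Matrix.mulVec_add, ← Matrix.mulVec_add]
    have h := hg.curvMatrix_bianchi hy (WithLp.toLp 2 fun i => B i c) (WithLp.toLp 2 fun i => B i d)
      (WithLp.toLp 2 fun i => B i b)
    rw [h, Matrix.mulVec_zero, dotProduct_zero]

theorem totalProj_frame {G P B : Tensor2} (hB : IsUnit B.det) (hG : pull B G = minkowski)
    {s : Fin 4 → ℝ} (hP : pull B P = Matrix.diagonal s)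
    (t : Fin 4 → Fin 4 → Fin 4 → Fin 4 → ℝ) (a b c d : Fin 4) :
    act Bᵀ (totalProj G P t) a b c d
      = (s a * ![-1, 1, 1, 1] a) * (s b * ![-1, 1, 1, 1] b) * (s c * ![-1, 1, 1, 1] c)
        * (s d * ![-1, 1, 1, 1] d) * act Bᵀ t a b c d := by
  have h : Bᵀ * (P * G⁻¹) = Matrix.diagonal (fun i => s i * ![-1, 1, 1, 1] i) * Bᵀ := by
    rw [pull_inv hB G, hG, minkowski_inv, minkowski, ← Matrix.diagonal_mul_diagonal, ← hP, pull]
    simp only [Matrix.mul_assoc]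
  rw [totalProj_eq_act, act_act, h, ← act_act, act_diagonal]

theorem proj_skew_time {F : Tensor2} (hF : ∀ a b, F b a = -F a b) (a b : Fin 4) :
    ![-1, 1, 0, 0] a * ![-1, 1, 1, 1] a * (![-1, 1, 0, 0] b * ![-1, 1, 1, 1] b) * F a b
      = F 0 1 * frameU a b := by
  have h := fun a => hF a a
  have h1 : ∀ a, F a a = 0 := fun a => by linarith [h a]
  fin_cases a <;> fin_cases b <;> simp [frameU, h1, hF 0 1]

theorem proj_skew_space {F : Tensor2} (hF : ∀ a b, F b a = -F a b) (a b : Fin 4) :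
    ![0, 0, 1, 1] a * ![-1, 1, 1, 1] a * (![0, 0, 1, 1] b * ![-1, 1, 1, 1] b) * F a b
      = F 2 3 * frameW a b := by
  have h := fun a => hF a a
  have h1 : ∀ a, F a a = 0 := fun a => by linarith [h a]
  fin_cases a <;> fin_cases b <;> simp [frameW, h1, hF 2 3]

/-- A plane has one 2-form up to scale, which is what `hF` encodes. Using it on each antisymmetric
index pair makes the projected curvature a multiple of `F ⊗ F`, with factor read off at `p q p q`.
-/
theorem totalProj_eq_iff {G P F B : Tensor2} (hB : IsUnit B.det) (hG : pull B G = minkowski)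
    {s : Fin 4 → ℝ} (hP : pull B P = Matrix.diagonal s)
    {R : Fin 4 → Fin 4 → Fin 4 → Fin 4 → ℝ} (hR : IsCurvatureLike (act Bᵀ R)) {p q : Fin 4}
    (hF : ∀ K : Tensor2, (∀ a b, K b a = -K a b) → ∀ a b,
      s a * ![-1, 1, 1, 1] a * (s b * ![-1, 1, 1, 1] b) * K a b = K p q * pull B F a b)
    (hpq : pull B F p q = 1) (c : ℝ) :
    (∀ i j k l, totalProj G P R i j k l = c * (F i j * F k l)) ↔ c = act Bᵀ R p q p q := by
  have h1 : ∀ a b c d, act Bᵀ (totalProj G P R) a b c d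
      = act Bᵀ R p q p q * (pull B F a b * pull B F c d) := by
    intro a b c d
    rw [totalProj_frame hB hG hP]
    have e1 := hF (Matrix.of fun c d => act Bᵀ R a b c d) (fun c d => hR.swap_right a b c d) c d
    have e2 := hF (Matrix.of fun a b => act Bᵀ R a b p q) (fun a b => hR.swap_left a b p q) a b
    simp only [Matrix.of_apply] at e1 e2
    linear_combination (s a * ![-1, 1, 1, 1] a * (s b * ![-1, 1, 1, 1] b)) * e1
      + pull B F c d * e2
  have h2 : (∀ i j k l, totalProj G P R i j k l = c * (F i j * F k l))
      ↔ totalProj G P R = fun i j k l => c * (F i j * F k l) := by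
    simp only [funext_iff]
  have hBT : IsUnit Bᵀ.det := by rwa [Matrix.det_transpose]
  rw [h2, ← (act_injective hBT).eq_iff, act_transpose_mul]
  constructor
  · intro h
    have := congrFun (congrFun (congrFun (congrFun h p) q) p) q
    rw [h1] at this
    simpa [hpq] using this.symm
  · rintro rfl
    funext a b c d
    exact h1 a b c d

/-- This gives existence and uniqueness of the pair at once, and lets any adapted frame be used to
evaluate it. -/
theorem isCurvaturePair_iff {η : E4 → Fin 4 → Fin 4 → Fin 4 → Fin 4 → ℝ} {u : E4 → Tensor2}
    (h : IsStructureOn g η u Ω) (hy : y ∈ Ω) {B : Tensor2}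
    (hB : IsAdapted (g y) (u y) (starField g η u y) B) (X Y : ℝ) :
    IsCurvaturePair g η u y X Y ↔ X = -act Bᵀ (riemann g y) 0 1 0 1
      ∧ Y = act Bᵀ (riemann g y) 2 3 2 3 := by
  have hd := hB.isUnit_det
  have hR := isCurvatureLike_frame h.metric hy B
  have hv : pull B (vProj g u y) = Matrix.diagonal ![-1, 1, 0, 0] := by
    rw [vProj, pull_dot hd, hB.metric, hB.form, dot_frameU]
  have hh : pull B (hProj g u y) = Matrix.diagonal ![0, 0, 1, 1] := by
    rw [hProj, vProj, pull_sub, pull_dot hd, hB.metric, hB.form, minkowski_sub_dot_frameU]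
  rw [IsCurvaturePair, totalProj_eq_iff hd hB.metric hv hR (p := 0) (q := 1)
    (by rw [hB.form]; exact fun K hK => proj_skew_time hK) (by rw [hB.form]; rfl),
    totalProj_eq_iff hd hB.metric hh hR (p := 2) (q := 3)
    (by rw [hB.dual]; exact fun K hK => proj_skew_space hK) (by rw [hB.dual]; rfl), neg_eq_iff_eq_neg]

end Curvature

/-! ### The Lie derivative of the metric through the connection. -/

section Lie

variable {g : E4 → Tensor2} {Ω : Set E4} {y : E4} {α : E4 → Fin 4 → ℝ}

/-- The Lie derivative of the metric is twice the symmetrized covariant derivative. -/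
theorem IsMetricOn.lieMetric_eq (hg : IsMetricOn g Ω) (hα : SmoothV α Ω) (hy : y ∈ Ω) :
    lieMetric g α y = Matrix.of (covDeriv₁ g α y) + (Matrix.of (covDeriv₁ g α y))ᵀ := by
  have hs : SmoothV (fun z => (g z)⁻¹ *ᵥ α z) Ω := hg.smooth_inv.mulVec hα
  have hα' : ∀ z ∈ Ω, g z *ᵥ ((g z)⁻¹ *ᵥ α z) = α z := fun z hz => by
    rw [Matrix.mulVec_mulVec, Matrix.mul_nonsing_inv _ (hg.isUnit_det hz), Matrix.one_mulVec]
  -- Differentiating `α = g s`, with `s` the raised vector, brings in the derivatives of `s` that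
  -- occur in the Lie derivative. On symmetrizing, the Christoffel terms of `hΓ` leave only `s^m ∂_m
  -- g_ij`.
  have hd : ∀ i j, pd i (fun z => α z j) y = ∑ m, (pd i (fun z => g z j m) y * ((g y)⁻¹ *ᵥ α y) m
      + g y j m * pd i (fun z => ((g z)⁻¹ *ᵥ α z) m) y) := by
    intro i j
    have h := dirV_mulVec hg.isOpen hg.smooth hs hy (x := EuclideanSpace.single i 1)
    rw [dirV_congr (β := α)] at h
    · have h' := congrFun h j
      rw [Finset.sum_add_distrib]
      exact h'
    · filter_upwards [hg.isOpen.mem_nhds hy] with z hz using hα' z hz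
  have hΓ : ∀ i j, ∑ m, christoffel g m i j y * α y m = ∑ k, (1 / 2) *
      (pd i (fun z => g z j k) y + pd j (fun z => g z i k) y - pd k (fun z => g z i j) y)
        * ((g y)⁻¹ *ᵥ α y) k := by
    intro i j
    simp only [← hg.lower_christoffel hy]
    have hm : ∀ m, α y m = ∑ k, g y m k * ((g y)⁻¹ *ᵥ α y) k := fun m =>
      (congrFun (hα' y hy) m).symm
    rw [Finset.sum_congr rfl fun m _ => by rw [hm m]]
    simp only [Finset.mul_sum, Finset.sum_mul]
    rw [Finset.sum_comm]
    refine Finset.sum_congr rfl fun k _ => Finset.sum_congr rfl fun m _ => ?_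
    rw [show g y m k = g y k m from congrFun (congrFun (hg.symm y hy) k) m]
    ring
  ext i j
  simp only [lieMetric, covDeriv₁, Matrix.add_apply, Matrix.transpose_apply, Matrix.of_apply]
  rw [hd, hd, hΓ, hΓ, ← Finset.sum_sub_distrib, ← Finset.sum_sub_distrib, ← Finset.sum_add_distrib]
  refine Finset.sum_congr rfl fun m _ => ?_
  rw [show g y m j = g y j m from congrFun (congrFun (hg.symm y hy) j) m, hg.pd_symm hy m j i]
  ring

end Lie

theorem IsMetricOn.smooth_codiff₂ {g : E4 → Tensor2} {Ω : Set E4} (hg : IsMetricOn g Ω)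
    {F : E4 → Tensor2}
    (hF : SmoothM F Ω) : SmoothV (codiff₂ g F) Ω := by
  intro j
  have : (fun z => codiff₂ g F z j) = fun z => -∑ k, ∑ i, (g z)⁻¹ k i *
      cov₂ g F (EuclideanSpace.single k 1) z i j := by
    simp only [codiff₂, covDeriv₂_eq]
  rw [this]
  exact (ContDiffOn.sum fun k _ => ContDiffOn.sum fun i _ =>
    (hg.smooth_inv k i).mul (hg.smooth_cov₂ hF _ i j)).neg

/-! ### The Ricci identity for `U` and the Ricci tensor in a chart. -/

namespace IsStructureOn

variable {g u : E4 → Tensor2} {η : E4 → Fin 4 → Fin 4 → Fin 4 → Fin 4 → ℝ} {Ω : Set E4} {y : E4}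
  {B : Tensor2}

theorem smooth_expansion (h : IsStructureOn g η u Ω) : SmoothV (expansion g η u) Ω :=
  (h.metric.smooth_app h.smooth_dual (h.metric.smooth_codiff₂ h.smooth_dual)).sub
    (h.metric.smooth_app h.smooth_form (h.metric.smooth_codiff₂ h.smooth_form))

theorem smooth_rotation (h : IsStructureOn g η u Ω) : SmoothV (rotation g η u) Ω :=
  (h.metric.smooth_app h.smooth_dual (h.metric.smooth_codiff₂ h.smooth_form)).add
    (h.metric.smooth_app h.smooth_form (h.metric.smooth_codiff₂ h.smooth_dual))

/-- The Ricci identity for the canonical 2-form of an umbilical structure. -/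
theorem ricci_identity (h : IsStructureOn g η u Ω) (hy : y ∈ Ω)
    (hv : ∀ z ∈ Ω, IsUmbilicalAt g (vProj g u) z) (hh : ∀ z ∈ Ω, IsUmbilicalAt g (hProj g u) z)
    (x w : E4) :
    covTwist (g y) (u y) (starField g η u y) (cov₂ g u x y) (cov₂ g (starField g η u) x y)
        (expansion g η u y) (rotation g η u y) (cov₁ g (expansion g η u) x y)
        (cov₁ g (rotation g η u) x y) w
      - covTwist (g y) (u y) (starField g η u y) (cov₂ g u w y) (cov₂ g (starField g η u) w y)
        (expansion g η u y) (rotation g η u y) (cov₁ g (expansion g η u) w y)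
        (cov₁ g (rotation g η u) w y) x
      = dot (g y) (g y * curvMatrix g x w y) (u y)
        - dot (g y) (u y) (g y * curvMatrix g x w y) := by
  have hm := h.metric
  have key : ∀ x w : E4, cov₂ g (cov₂ g u w) x y
      = cov₂ g (fun z => twist (g z) (u z) (starField g η u z) (expansion g η u z)
          (rotation g η u z) w) x y := fun x w =>
    h.cov_eq_of_eqOn (fun z hz => h.cov_form_eq_twist hz (hv z hz) (hh z hz) w) hy x
  have hr := hm.cov_comm h.smooth_form hy (x := x) (w := w)
  -- The two terms from the non-parallel `w` and `x` are `twist` at `Γ_x w` and at `Γ_w x`; these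
  -- are equal by absence of torsion and cancel in the difference.
  rw [key, key, hm.cov_twist h.smooth_form h.smooth_dual h.smooth_expansion h.smooth_rotation hy,
    hm.cov_twist h.smooth_form h.smooth_dual h.smooth_expansion h.smooth_rotation hy,
    hm.connMatrix_mulVec_comm hy (x := w), add_sub_add_right_eq_sub] at hr
  rw [hr]
  have ha := hm.metric_curvMatrix_antisymm hy (x := x) (w := w)
  -- Metric antisymmetry converts the transposed curvature operator, so that both curvature terms
  -- become `dot` products with the lowered curvature.
  have h1 : (curvMatrix g x w y)ᵀ = -(g y * curvMatrix g x w y * (g y)⁻¹) := by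
    rw [eq_neg_of_add_eq_zero_right ha, Matrix.neg_mul, neg_neg,
      Matrix.mul_nonsing_inv_cancel_right _ _ (hm.isUnit_det hy)]
  rw [h1, dot, dot, Matrix.mul_assoc (u y), Matrix.nonsing_inv_mul_cancel_left _ _
    (hm.isUnit_det hy), Matrix.neg_mul, neg_neg]

theorem frame_ricci_identity (h : IsStructureOn g η u Ω) (hy : y ∈ Ω)
    (hB : IsAdapted (g y) (u y) (starField g η u y) B)
    (hv : ∀ z ∈ Ω, IsUmbilicalAt g (vProj g u) z) (hh : ∀ z ∈ Ω, IsUmbilicalAt g (hProj g u) z)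
    {Φ Ψ : Fin 4 → ℝ} (hΦ : Bᵀ *ᵥ expansion g η u y = Φ) (hΨ : Bᵀ *ᵥ rotation g η u y = Ψ)
    {DΦ DΨ : Tensor2} (hDΦ : pull B (Matrix.of (covDeriv₁ g (expansion g η u) y)) = DΦ)
    (hDΨ : pull B (Matrix.of (covDeriv₁ g (rotation g η u) y)) = DΨ) (l k : Fin 4) :
    covTwist minkowski frameU frameW (frameDU Φ Ψ l) (frameDW Φ Ψ l) Φ Ψ (DΦ l) (DΨ l)
        (Pi.single k 1)
      - covTwist minkowski frameU frameW (frameDU Φ Ψ k) (frameDW Φ Ψ k) Φ Ψ (DΦ k) (DΨ k)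
        (Pi.single l 1)
      = dot minkowski (Matrix.of fun a b => act Bᵀ (riemann g y) a b l k) frameU
        - dot minkowski frameU (Matrix.of fun a b => act Bᵀ (riemann g y) a b l k) := by
  have hd := hB.isUnit_det
  have h1 := congrArg (pull B) (h.ricci_identity hy hv hh (frameVec B l) (frameVec B k))
  obtain ⟨e1, e2⟩ := h.frame_cov hy hB (hv y hy) (hh y hy)
  rw [hΦ, hΨ] at e1 e2
  have e1 := congrFun e1
  have e2 := congrFun e2
  have f1 : ∀ a, Bᵀ *ᵥ cov₁ g (expansion g η u) (frameVec B a) y = DΦ a := fun a => by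
    rw [← hDΦ]
    exact funext fun c => (pull_covDeriv₁ g _ B y a c).symm
  have f2 : ∀ a, Bᵀ *ᵥ cov₁ g (rotation g η u) (frameVec B a) y = DΨ a := fun a => by
    rw [← hDΨ]
    exact funext fun c => (pull_covDeriv₁ g _ B y a c).symm
  have f3 : pull B (g y * curvMatrix g (frameVec B l) (frameVec B k) y)
      = Matrix.of fun a b => act Bᵀ (riemann g y) a b l k := by
    ext a b
    exact (act_transpose_riemann h.metric hy B a b l k).symm
  simp only [pull_sub, frameVec_ofLp, pull_covTwist hd, pull_dot hd, hB.metric, hB.form, hB.dual,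
    hΦ, hΨ, e1, e2, f1, f2, f3] at h1
  exact h1

/-- The Ricci tensor of an umbilical 2+2 structure, in coordinates. -/
theorem ricci_eq (h : IsStructureOn g η u Ω) (hy : y ∈ Ω)
    (hv : ∀ z ∈ Ω, IsUmbilicalAt g (vProj g u) z) (hh : ∀ z ∈ Ω, IsUmbilicalAt g (hProj g u) z)
    {X Y : ℝ} (hXY : IsCurvaturePair g η u y X Y) :
    ricci g y =
      (1 / 4 : ℝ) • (scalarRHat g η u y X Y • g y + scalarSmallRHat g η u y X Y • structureTensor g u y)
      + (1 / 2 : ℝ) • (tensorM g η u y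
        - dot (g y) (dot (g y) (u y) (tensorN g η u y)) (starField g η u y)
        - dot (g y) (dot (g y) (starField g η u y) (tensorN g η u y)) (u y)) := by
  obtain ⟨B, hB⟩ := h.frame y hy
  have hd := hB.isUnit_det
  obtain ⟨rfl, rfl⟩ := (isCurvaturePair_iff h hy hB X Y).1 hXY
  have hP : pull B (structureTensor g u y) = Matrix.diagonal ![-1, 1, -1, -1] := by
    rw [structureTensor, hProj, vProj, pull_sub, pull_sub, pull_dot hd, hB.metric, hB.form,
      minkowski_sub_dot_frameU, dot_frameU, Matrix.diagonal_sub]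
    congr 1
    ext i
    fin_cases i <;> simp
  have hI : (g y)⁻¹ = B * minkowski * Bᵀ := by
    rw [pull_inv hd (g y), hB.metric, minkowski_inv]
  have hPI : (g y)⁻¹ * structureTensor g u y * (g y)⁻¹ᵀ
      = B * Matrix.diagonal ![-1, 1, -1, -1] * Bᵀ := by
    have h1 : minkowski * Matrix.diagonal ![-1, 1, -1, -1] * minkowski
        = Matrix.diagonal ![-1, 1, -1, -1] := by
      rw [minkowski, Matrix.diagonal_mul_diagonal, Matrix.diagonal_mul_diagonal]
      congr 1
      ext i
      fin_cases i <;> simp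
    rw [← h1, ← hP, pull, hI]
    simp only [Matrix.transpose_mul, Matrix.transpose_transpose, Matrix.mul_assoc,
      show minkowskiᵀ = minkowski from Matrix.diagonal_transpose _]
  have hsum : ∀ C : Tensor2, ∑ i, ∑ j, (B * C * Bᵀ) i j * covDeriv₁ g (expansion g η u) y i j
      = ∑ i, ∑ j, C i j * pull B (Matrix.of (covDeriv₁ g (expansion g η u) y)) i j :=
    fun C => sum_mul_pull B C (Matrix.of (covDeriv₁ g (expansion g η u) y))
  apply pull_injective hd
  ext b d
  rw [pull_ricci h.metric hy hd, hB.metric, minkowski_inv,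
    ricci_eq_frameRicci (isCurvatureLike_frame h.metric hy B)
      (h.frame_ricci_identity hy hB hv hh rfl rfl rfl rfl)]
  simp only [frameRicci, scalarRHat, scalarSmallRHat, tensorM, tensorN, codiff₁, codiffWith, tensor,
    h.metric.lieMetric_eq h.smooth_expansion hy, h.metric.lieMetric_eq h.smooth_rotation hy,
    contract_pull hd (g y), pull_add, pull_sub, pull_smul, pull_dot hd, pull_transpose,
    pull_vecMulVec, hB.metric, hB.form, hB.dual, hP, hPI, hsum]
  rw [hI]
  simp only [hsum]

end IsStructureOn

/-! ### The Hodge dual and the volume form under a change of frame. -/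

theorem pull_star (B G F : Tensor2) (hB : IsUnit B.det) (η : Fin 4 → Fin 4 → Fin 4 → Fin 4 → ℝ)
    (a b : Fin 4) :
    pull B (star G η F) a b = (1 / 2) * ∑ c, ∑ d, act Bᵀ η a b c d
      * ((pull B G)⁻¹ * pull B F * (pull B G)⁻¹ᵀ) c d := by
  have h : G⁻¹ * F * G⁻¹ᵀ = B * ((pull B G)⁻¹ * pull B F * (pull B G)⁻¹ᵀ) * Bᵀ := by
    rw [pull_inv hB G]
    simp only [pull, Matrix.transpose_mul, Matrix.transpose_transpose, Matrix.mul_assoc]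
  set C := (pull B G)⁻¹ * pull B F * (pull B G)⁻¹ᵀ with hC
  have h2 : ∀ i j, star G η F i j = (1 / 2) * ∑ c, ∑ d, C c d * pull B (Matrix.of (η i j)) c d := by
    intro i j
    rw [← sum_mul_pull, ← h, star, Matrix.of_apply]
    congr 1
    exact Finset.sum_congr rfl fun k _ => Finset.sum_congr rfl fun l _ => mul_comm _ _
  rw [pull_eq_sum]
  simp only [h2, pull_eq_sum B (Matrix.of _), act, Matrix.transpose_apply, Matrix.of_apply,
    Finset.mul_sum, Finset.sum_mul]
  rw [sum_comm₄]
  refine Finset.sum_congr rfl fun c _ => Finset.sum_congr rfl fun d _ =>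
    Finset.sum_congr rfl fun i _ => Finset.sum_congr rfl fun j _ =>
    Finset.sum_congr rfl fun k _ => Finset.sum_congr rfl fun l _ => by ring

theorem smooth_starField {g u : E4 → Tensor2} {η : E4 → Fin 4 → Fin 4 → Fin 4 → Fin 4 → ℝ}
    {Ω : Set E4} (hg : SmoothM (fun z => (g z)⁻¹) Ω) (hu : SmoothM u Ω)
    (hη : ∀ i j k l, ContDiffOn ℝ ∞ (fun z => η z i j k l) Ω) : SmoothM (starField g η u) Ω :=
  fun i j => contDiffOn_const.mul (ContDiffOn.sum fun k _ => ContDiffOn.sum fun l _ =>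
    (hη i j k l).mul (((hg.mul hu).mul hg.transpose) k l))

end Coord

section AlternatingMap

variable {V : Type*} [AddCommGroup V] [Module ℝ V] (f : V [⋀^Fin 4]→ₗ[ℝ] ℝ)

theorem AlternatingMap.map_slot_sum (v : Fin 4 → V) (s : Fin 4) (c : Fin 4 → ℝ) (x : Fin 4 → V) :
    f (Function.update v s (∑ i, c i • x i)) = ∑ i, c i * f (Function.update v s (x i)) := by
  rw [AlternatingMap.map_update_sum]
  exact Finset.sum_congr rfl fun i _ => by rw [AlternatingMap.map_update_smul, smul_eq_mul]

theorem AlternatingMap.apply_frame (B : Matrix (Fin 4) (Fin 4) ℝ) (x b : Fin 4 → V)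
    (hb : ∀ a, b a = ∑ i, B i a • x i) (a₀ a₁ a₂ a₃ : Fin 4) :
    f ![b a₀, b a₁, b a₂, b a₃]
      = Coord.act Bᵀ (fun i j k l => f ![x i, x j, x k, x l]) a₀ a₁ a₂ a₃ := by
  have s0 : ∀ (c : Fin 4 → ℝ) (y₁ y₂ y₃ : V),
      f ![∑ i, c i • x i, y₁, y₂, y₃] = ∑ i, c i * f ![x i, y₁, y₂, y₃] := by
    intro c y₁ y₂ y₃
    have h := f.map_slot_sum ![0, y₁, y₂, y₃] 0 c x
    have e : ∀ y, Function.update ![0, y₁, y₂, y₃] 0 y = ![y, y₁, y₂, y₃] := fun y => by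
      ext i; fin_cases i <;> rfl
    simpa only [e] using h
  have s1 : ∀ (c : Fin 4 → ℝ) (y₁ y₂ y₃ : V),
      f ![y₁, ∑ i, c i • x i, y₂, y₃] = ∑ i, c i * f ![y₁, x i, y₂, y₃] := by
    intro c y₁ y₂ y₃
    have h := f.map_slot_sum ![y₁, 0, y₂, y₃] 1 c x
    have e : ∀ y, Function.update ![y₁, 0, y₂, y₃] 1 y = ![y₁, y, y₂, y₃] := fun y => by
      ext i; fin_cases i <;> rfl
    simpa only [e] using h
  have s2 : ∀ (c : Fin 4 → ℝ) (y₁ y₂ y₃ : V),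
      f ![y₁, y₂, ∑ i, c i • x i, y₃] = ∑ i, c i * f ![y₁, y₂, x i, y₃] := by
    intro c y₁ y₂ y₃
    have h := f.map_slot_sum ![y₁, y₂, 0, y₃] 2 c x
    have e : ∀ y, Function.update ![y₁, y₂, 0, y₃] 2 y = ![y₁, y₂, y, y₃] := fun y => by
      ext i; fin_cases i <;> rfl
    simpa only [e] using h
  have s3 : ∀ (c : Fin 4 → ℝ) (y₁ y₂ y₃ : V),
      f ![y₁, y₂, y₃, ∑ i, c i • x i] = ∑ i, c i * f ![y₁, y₂, y₃, x i] := by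
    intro c y₁ y₂ y₃
    have h := f.map_slot_sum ![y₁, y₂, y₃, 0] 3 c x
    have e : ∀ y, Function.update ![y₁, y₂, y₃, 0] 3 y = ![y₁, y₂, y₃, y] := fun y => by
      ext i; fin_cases i <;> rfl
    simpa only [e] using h
  simp only [hb, s0, s1, s2, s3, Coord.act, Matrix.transpose_apply, Finset.mul_sum]
  refine Finset.sum_congr rfl fun i _ => Finset.sum_congr rfl fun j _ =>
    Finset.sum_congr rfl fun k _ => Finset.sum_congr rfl fun l _ => by ring

end AlternatingMap

/-! ### From the manifold to a chart: adapted frames in coordinates. -/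

section Charts
variable {M : Type*} [TopologicalSpace M] [ChartedSpace E4 M]

/-- The inverse chart has surjective derivative, so a frame of the tangent space has a matrix in the
coordinate vectors. -/
theorem coordVec_span {e : OpenPartialHomeomorph M E4}
    (he : e ∈ IsManifold.maximalAtlas (𝓡 4) ∞ M) {y : E4} (hy : y ∈ e.target)
    (v : TangentSpace (𝓡 4) (e.symm y)) : ∃ c : Fin 4 → ℝ, v = ∑ i, c i • coordVec e y i := by
  have hd : e.MDifferentiable (𝓡 4) (𝓡 4) :=
    ⟨(contMDiffOn_of_mem_maximalAtlas he).mdifferentiableOn (by simp),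
      (contMDiffOn_symm_of_mem_maximalAtlas he).mdifferentiableOn (by simp)⟩
  obtain ⟨x, hx⟩ : ∃ x : E4, mfderiv (𝓡 4) (𝓡 4) e.symm y x = v :=
    hd.symm.mfderiv_surjective (x := y) hy v
  refine ⟨fun i => x i, ?_⟩
  have h : x = ∑ k, x k • EuclideanSpace.single k (1 : ℝ) := by
    ext i
    simp [Finset.sum_apply, Pi.single_apply]
  have h2 : mfderiv (𝓡 4) (𝓡 4) e.symm y x = ∑ k, x k • coordVec e y k := by
    conv_lhs => rw [h]
    exact (map_sum _ _ _).trans (Finset.sum_congr rfl fun k _ => map_smul _ _ _)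
  exact hx.symm.trans h2

end Charts

section AdaptedFrames

theorem LinearMap.BilinForm.pull_eq {V : Type*} [AddCommGroup V] [Module ℝ V]
    (T : LinearMap.BilinForm ℝ V) (B : Matrix (Fin 4) (Fin 4) ℝ) (x b : Fin 4 → V)
    (hb : ∀ a, b a = ∑ i, B i a • x i) (a c : Fin 4) :
    Coord.pull B (Matrix.of fun i j => T (x i) (x j)) a c = T (b a) (b c) := by
  rw [Coord.pull_eq_sum, hb, hb]
  simp only [map_sum, LinearMap.sum_apply, map_smul, LinearMap.smul_apply, smul_eq_mul,
    Matrix.of_apply, Finset.mul_sum]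
  rw [Finset.sum_comm]
  refine Finset.sum_congr rfl fun i _ => Finset.sum_congr rfl fun j _ => by ring

/-- The volume element of an adapted frame may be assumed to be `-1`. -/
theorem exists_negative_frame {V : Type*} [AddCommGroup V] [Module ℝ V]
    {G U : LinearMap.BilinForm ℝ V} {η : V [⋀^Fin 4]→ₗ[ℝ] ℝ}
    (hη : ∀ b, IsLorentzFrame G b → η b = 1 ∨ η b = -1)
    (hU : ∃ b, IsLorentzFrame G b ∧ U (b 0) (b 1) = 1 ∧ ∀ x, U (b 2) x = 0 ∧ U (b 3) x = 0) :
    ∃ b, IsLorentzFrame G b ∧ U (b 0) (b 1) = 1 ∧ (∀ x, U (b 2) x = 0 ∧ U (b 3) x = 0) ∧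
      η b = -1 := by
  obtain ⟨b, hb, h01, h23⟩ := hU
  rcases hη b hb with h | h
  -- Exchanging the two space-like vectors of `H` reverses the sign of the volume and leaves `U`
  -- unchanged.
  · refine ⟨b ∘ Equiv.swap 2 3, fun i j => ?_, ?_, fun x => ?_, ?_⟩
    · rw [Function.comp_apply, Function.comp_apply, hb]
      fin_cases i <;> fin_cases j <;> rfl
    · exact h01
    · exact ⟨(h23 x).2, (h23 x).1⟩
    · rw [AlternatingMap.map_swap _ _ (by decide), h]
  · exact ⟨b, hb, h01, h23, h⟩

variable {M : Type*} [TopologicalSpace M] [ChartedSpace E4 M]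

theorem OrientedSpacetime.exists_isAdapted (S : OrientedSpacetime M)
    {U : ∀ p : M, LinearMap.BilinForm ℝ (TangentSpace (𝓡 4) p)} (hU : S.IsCanonicalForm U)
    {e : OpenPartialHomeomorph M E4} (he : e ∈ IsManifold.maximalAtlas (𝓡 4) ∞ M)
    {y : E4} (hy : y ∈ e.target) :
    ∃ B, Coord.IsAdapted (comp₂ S.metric e y) (comp₂ U e y)
      (Coord.starField (comp₂ S.metric e) (comp₄ S.volume e) (comp₂ U e) y) B := by
  obtain ⟨b, hb, h01, h23, hvol⟩ :=
    exists_negative_frame (S.volume_frame (e.symm y)) (hU.simple (e.symm y))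
  choose c hc using fun a => coordVec_span he hy (b a)
  set B : Tensor2 := Matrix.of fun i a => c a i with hBdef
  have hg : Coord.pull B (comp₂ S.metric e y) = Coord.minkowski := by
    ext a d
    rw [comp₂, (S.metric (e.symm y)).pull_eq B (coordVec e y) b hc, hb, Coord.minkowski]
  have hu : Coord.pull B (comp₂ U e y) = Coord.frameU := by
    ext a d
    rw [comp₂, (U (e.symm y)).pull_eq B (coordVec e y) b hc]
    have hs : ∀ v w, U (e.symm y) v w = -U (e.symm y) w v := fun v w =>
      (LinearMap.IsAlt.neg (hU.alt (e.symm y)) w v).symm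
    have h2 := fun x => (h23 x).1
    have h3 := fun x => (h23 x).2
    have h2' : ∀ x, U (e.symm y) x (b 2) = 0 := fun x => by rw [hs, h2, neg_zero]
    have h3' : ∀ x, U (e.symm y) x (b 3) = 0 := fun x => by rw [hs, h3, neg_zero]
    have h00 := hU.alt (e.symm y) (b 0)
    have h11 := hU.alt (e.symm y) (b 1)
    have h10 : U (e.symm y) (b 1) (b 0) = -1 := by rw [hs, h01]
    fin_cases a <;> fin_cases d <;> simp [Coord.frameU, h2, h3, h2', h3', h00, h11, h01, h10]
  have hdet : IsUnit B.det := by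
    have := congrArg Matrix.det hg
    rw [Coord.pull, Matrix.det_mul, Coord.det_minkowski] at this
    refine isUnit_iff_ne_zero.2 fun h0 => ?_
    rw [h0, mul_zero] at this
    norm_num at this
  refine ⟨B, hg, hu, ?_⟩
  set vol := S.volume (e.symm y) with hvoldef
  have hη : ∀ a b' c d, Coord.act Bᵀ (comp₄ S.volume e y) a b' c d = vol ![b a, b b', b c, b d] :=
    fun a b' c d => (vol.apply_frame B (coordVec e y) b hc a b' c d).symm
  -- Raising both indices of `U_01` meets one time-like index, hence the sign. It is why volume `-1`
  -- is the choice that gives `*U` the component `+1` on `b 2, b 3`.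
  have hC : Coord.minkowski⁻¹ * Coord.frameU * Coord.minkowski⁻¹ᵀ = -Coord.frameU := by
    rw [Coord.minkowski_inv, Coord.minkowski, Matrix.diagonal_transpose]
    ext i j
    fin_cases i <;> fin_cases j <;> simp [Coord.frameU, Matrix.diagonal_mul, Matrix.mul_diagonal]
  have hstar : ∀ a d, Coord.pull B (Coord.starField (comp₂ S.metric e) (comp₄ S.volume e)
      (comp₂ U e) y) a d = -vol ![b a, b d, b 0, b 1] := by
    intro a d
    have hsw : vol ![b a, b d, b 1, b 0] = -vol ![b a, b d, b 0, b 1] := by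
      rw [← vol.map_swap _ (show (2 : Fin 4) ≠ 3 by decide)]
      congr 1
      ext i
      fin_cases i <;> rfl
    rw [Coord.starField, Coord.pull_star _ _ _ hdet, hg, hu, hC]
    simp [hη, Fin.sum_univ_four, Coord.frameU, hsw]
    ring
  have hz : ∀ (v : Fin 4 → TangentSpace (𝓡 4) (e.symm y)) (i j : Fin 4), v i = v j → i ≠ j →
      vol v = 0 := fun v i j h hij => vol.map_eq_zero_of_eq v h hij
  have hb' : vol ![b 2, b 3, b 0, b 1] = -1 := by
    have h1 : vol ![b 2, b 3, b 0, b 1] = -vol ![b 0, b 3, b 2, b 1] := by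
      rw [← vol.map_swap _ (show (0 : Fin 4) ≠ 2 by decide)]
      congr 1
      ext i
      fin_cases i <;> rfl
    have h2 : vol ![b 0, b 3, b 2, b 1] = -vol b := by
      rw [← vol.map_swap _ (show (1 : Fin 4) ≠ 3 by decide)]
      congr 1
      ext i
      fin_cases i <;> rfl
    rw [h1, h2, hvol, neg_neg]
  have hb'' : vol ![b 3, b 2, b 0, b 1] = 1 := by
    have h1 : vol ![b 3, b 2, b 0, b 1] = -vol ![b 2, b 3, b 0, b 1] := by
      rw [← vol.map_swap _ (show (0 : Fin 4) ≠ 1 by decide)]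
      congr 1
      ext i
      fin_cases i <;> rfl
    rw [h1, hb', neg_neg]
  have e0 : ∀ v, vol ![b 0, v, b 0, b 1] = 0 := fun v => hz _ 0 2 rfl (by decide)
  have e1 : ∀ v, vol ![b 1, v, b 0, b 1] = 0 := fun v => hz _ 0 3 rfl (by decide)
  have e2 : ∀ v, vol ![v, b 0, b 0, b 1] = 0 := fun v => hz _ 1 2 rfl (by decide)
  have e3 : ∀ v, vol ![v, b 1, b 0, b 1] = 0 := fun v => hz _ 1 3 rfl (by decide)
  have e4 : ∀ v, vol ![v, v, b 0, b 1] = 0 := fun v => hz _ 0 1 rfl (by decide)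
  ext a d
  rw [hstar]
  fin_cases a <;> fin_cases d <;> simp [Coord.frameW, e0, e1, e2, e3, e4, hb', hb'']

theorem OrientedSpacetime.isStructureOn (S : OrientedSpacetime M)
    {U : ∀ p : M, LinearMap.BilinForm ℝ (TangentSpace (𝓡 4) p)} (hU : S.IsCanonicalForm U)
    {e : OpenPartialHomeomorph M E4} (he : e ∈ IsManifold.maximalAtlas (𝓡 4) ∞ M) :
    Coord.IsStructureOn (comp₂ S.metric e) (comp₄ S.volume e) (comp₂ U e) e.target := by
  have hm : Coord.IsMetricOn (comp₂ S.metric e) e.target :=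
    { isOpen := e.open_target
      smooth := S.metric_smooth e he
      symm := fun z _ => by
        ext i j
        exact S.metric_symm _ _ _
      det_ne_zero := fun z hz h0 => by
        obtain ⟨B, hB⟩ := S.exists_isAdapted hU he hz
        have := congrArg Matrix.det hB.metric
        rw [Coord.pull, Matrix.det_mul, Matrix.det_mul, Coord.det_minkowski, h0] at this
        norm_num at this }
  exact ⟨hm, hU.smooth e he, Coord.smooth_starField hm.smooth_inv (hU.smooth e he)
    (S.volume_smooth e he), fun z hz => S.exists_isAdapted hU he hz⟩

end AdaptedFrames

end

theorem mainTheorem2 {M : Type*} [TopologicalSpace M] [ChartedSpace E4 M] [IsManifold (𝓡 4) ∞ M]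
    (S : OrientedSpacetime M) (U : ∀ p : M, LinearMap.BilinForm ℝ (TangentSpace (𝓡 4) p))
    (hU : S.IsUmbilicalStructure U)
    (e : OpenPartialHomeomorph M E4) (he : e ∈ IsManifold.maximalAtlas (𝓡 4) ∞ M)
    (g : E4 → Tensor2) (hg : g = comp₂ S.metric e)
    (η : E4 → Fin 4 → Fin 4 → Fin 4 → Fin 4 → ℝ) (hη : η = comp₄ S.volume e)
    (u : E4 → Tensor2) (hu : u = comp₂ U e)
    (y : E4) (hy : y ∈ e.target) :
    (∃! XY : ℝ × ℝ, Coord.IsCurvaturePair g η u y XY.1 XY.2) ∧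
    ∀ X Y : ℝ, Coord.IsCurvaturePair g η u y X Y →
      Coord.ricci g y =
        (1 / 4 : ℝ) • (Coord.scalarRHat g η u y X Y • g y
          + Coord.scalarSmallRHat g η u y X Y • Coord.structureTensor g u y)
        + (1 / 2 : ℝ) • (Coord.tensorM g η u y
          - Coord.dot (g y) (Coord.dot (g y) (u y) (Coord.tensorN g η u y))
              (Coord.starField g η u y)
          - Coord.dot (g y) (Coord.dot (g y) (Coord.starField g η u y) (Coord.tensorN g η u y))
              (u y)) := by
  subst hg hη hu
  have hS := S.isStructureOn hU.canonical he
  -- Umbilicity is supplied on the whole chart domain, because the formula for `∇U` is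
  -- differentiated.
  refine ⟨?_, fun X Y hXY => hS.ricci_eq hy (fun z hz => (hU.umbilical e he z hz).1)
    (fun z hz => (hU.umbilical e he z hz).2) hXY⟩
  obtain ⟨B, hB⟩ := hS.frame y hy
  simp only [Coord.isCurvaturePair_iff hS hy hB]
  exact ⟨(_, _), ⟨rfl, rfl⟩, fun XY h => Prod.ext h.1 h.2⟩
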